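/- Setting. A binary code is an injective map $C:\{0,1\}^k\to\{0,1\}^n$ with $k\ge 1$. Write $\Delta(u,v)$ for the relative Hamming distance of $u,v\in\{0,1\}^n$, let $\delta_C=\min_{x\ne y}\Delta(C(x),C(y))$, and call $w$ $\delta$-close to $C(x)$ if $\Delta(w,C(x))\le\delta$. A randomised algorithm $D$ that receives an index $i\in[k]$ and oracle access to a string $w\in\{0,1\}^n$, and outputs an element $D^w(i)$ of $\{0,1,\bot\}$, is a relaxed local decoder for $C$ with decoding radius $\delta\in(0,\delta_C/2)$ if for all $i\in[k]$ and $x\in\{0,1\}^k$: 1. (completeness) $\Pr[D^{C(x)}(i)=x_i]\ge 2/3$; 2. (relaxed decoding) $\Pr[D^{w}(i)\in\{x_i,\bot\}]\ge 2/3$ for every $w\in\{0,1\}^n$ that is $\delta$-close to $C(x)$. It has success rate $\rho$ at radius $\delta$ if for all $x$ and every $w$ that is $\delta$-close to $C(x)$ there is a set $I_w\subseteq[k]$ with $|I_w|\ge\rho k$ and $\Pr[D^w(i)=x_i]\ge 2/3$ for all $i\in I_w$. Its query complexity is the maximal number of (possibly adaptive) queries over all indices, strings and coin tosses. A sample-based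 algorithm with sample complexity at most $s$ selects each coordinate of $[n]$ independently with some probability $p$; if at most $s$ coordinates are selected it reads $w$ exactly on these, and its output depends only on the index, the selected set, the values read and its own coins; if more are selected, it reads nothing and its output does not depend on $w$. Corollary 7.4. There is an absolute constant $c>0$ such that for every integer $q\ge 2$ and every real $\delta>0$ there are $\rho>0$, $n_0\in\mathbb N$ and a function $n_1:(0,\infty)\to\mathbb N$ (all depending only on $q$ and $\delta$) with the following property. Let $n\ge n_0$, $k\ge1$, and let $C:\{0,1\}^k\to\{0,1\}^n$ be a binary code with $\delta<\delta_C/2$ that admits a relaxed local decoder with decoding radius $\delta/2$ and query complexity at most $q$. Then $C$ admits a sample-based relaxed local decoder $D'$ with decoding radius $\delta$ and sample complexity at most $$n^{\,1-\frac{1}{c\,q^2\log^2 q}}.$$ Moreover, $D'$ has success rate $\rho$ at radius $\delta$ whenever $\delta_C\ge 2\delta+\eta$ for some $\eta>0$ with $n\ge n_1(\eta)$. -/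

import Mathlib

open scoped NNReal ENNReal

noncomputable section

namespace RelaxedLDC

/-- Binary strings of length `n`. -/
abbrev Word (n : ℕ) : Type := Fin n → Bool

/-- Relative Hamming distance of two strings of length `n`;
`x` is `ε`-close to `y` when `relDist x y ≤ ε`. -/
def relDist {n : ℕ} (x y : Word n) : ℝ := (hammingDist x y : ℝ) / n

/-- Relative distance of a code: the minimum of `relDist (C x) (C y)` over distinct messages.
(For `k ≥ 1` this is a minimum over a finite nonempty set.) -/
def codeDist {k n : ℕ} (C : Word k → Word n) : ℝ :=
  sInf {d : ℝ | ∃ x y : Word k, x ≠ y ∧ d = relDist (C x) (C y)}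

/-! ### Relaxed decoders

The output alphabet is `Option Bool`, where `none` is the abort symbol `⊥`.
The behaviour of a randomised decoder is the map that sends an index `i` and an oracle `w`
to the distribution of the output on index `i` when the oracle is `w`. -/

/-- Completeness and relaxed decoding, with decoding radius `δ`. -/
structure IsRelaxedDecoder {k n : ℕ} (C : Word k → Word n) (δ : ℝ)
    (run : Fin k → Word n → PMF (Option Bool)) : Prop where
  completeness : ∀ (i : Fin k) (x : Word k), 2 / 3 ≤ run i (C x) (some (x i))
  relaxed_decoding : ∀ (i : Fin k) (w : Word n) (x : Word k), relDist w (C x) ≤ δ →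
    2 / 3 ≤ run i w (some (x i)) + run i w none

/-- Success rate `ρ`, with decoding radius `δ`: on every string that is `δ`-close to a codeword,
at least `ρ k` of the message bits are decoded correctly with probability at least `2/3`. -/
def HasSuccessRate {k n : ℕ} (C : Word k → Word n) (δ ρ : ℝ)
    (run : Fin k → Word n → PMF (Option Bool)) : Prop :=
  ∀ (w : Word n) (x : Word k), relDist w (C x) ≤ δ →
    ∃ I : Finset (Fin k), ρ * k ≤ (I.card : ℝ) ∧ ∀ i ∈ I, 2 / 3 ≤ run i w (some (x i))

/-! ### Query algorithms -/

/-- Adaptive deterministic query algorithms on strings of length `n`. -/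
inductive DecisionTree (n : ℕ) : Type
  | leaf (b : Option Bool) : DecisionTree n
  | query (j : Fin n) (next : Bool → DecisionTree n) : DecisionTree n

namespace DecisionTree

/-- The output of the tree on the string `w`. -/
def eval {n : ℕ} (w : Word n) : DecisionTree n → Option Bool
  | leaf b => b
  | query j next => eval w (next (w j))

/-- The number of queries that the tree makes on the string `w`. -/
def numQueries {n : ℕ} (w : Word n) : DecisionTree n → ℕ
  | leaf _ => 0
  | query j next => numQueries w (next (w j)) + 1

end DecisionTree

/-- A randomised (adaptive) query algorithm with explicit input `i : Fin k` and query access to a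
string of length `n`: for every explicit input, a distribution over decision trees. -/
structure QueryAlgorithm (k n : ℕ) where
  tree : Fin k → PMF (DecisionTree n)

namespace QueryAlgorithm

/-- The output distribution on index `i` and oracle `w`. -/
def run {k n : ℕ} (D : QueryAlgorithm k n) (i : Fin k) (w : Word n) : PMF (Option Bool) :=
  (D.tree i).map (DecisionTree.eval w)

/-- On every input and for every outcome of the coins, at most `q` queries are made. -/
def QueryComplexityLE {k n : ℕ} (D : QueryAlgorithm k n) (q : ℕ) : Prop :=
  ∀ i : Fin k, ∀ T ∈ (D.tree i).support, ∀ w : Word n, T.numQueries w ≤ q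

end QueryAlgorithm

/-! ### Sample-based algorithms -/

/-- The random subset of `Fin n` that contains each coordinate independently with
probability `p`. -/
def bernoulliSubset (n : ℕ) (p : ℝ≥0) (hp : p ≤ 1) : PMF (Finset (Fin n)) :=
  PMF.ofFintype (fun Q => ((p ^ Q.card * (1 - p) ^ (n - Q.card) : ℝ≥0) : ℝ≥0∞)) (by
    rw [← ENNReal.ofNNReal_finsetSum, Fin.sum_pow_mul_eq_add_pow, add_tsub_cancel_of_le hp,
      one_pow, ENNReal.coe_one])

/-- A sample-based algorithm with explicit input `i : Fin k` and access to a string `w` of length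
`n`. It selects a random set `Q` of coordinates, each independently with probability `prob`.
If `Q` has at most `cap` elements, it reads `w` on `Q` and its (possibly randomised) output depends
on `i`, `Q` and the restriction of `w` to `Q` (`out`); otherwise it reads nothing, and its output
does not depend on `w` (`overflow`). Hence it never reads more than `cap` coordinates:
`cap` is its sample complexity. -/
structure SampleAlgorithm (k n : ℕ) where
  prob : ℝ≥0
  prob_le_one : prob ≤ 1
  cap : ℕ
  out : Fin k → (Q : Finset (Fin n)) → (Q → Bool) → PMF (Option Bool)
  overflow : Fin k → Finset (Fin n) → PMF (Option Bool)

/-- The output distribution of a sample-based algorithm on index `i` and oracle `w`. -/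
def SampleAlgorithm.run {k n : ℕ} (A : SampleAlgorithm k n) (i : Fin k) (w : Word n) :
    PMF (Option Bool) :=
  (bernoulliSubset n A.prob A.prob_le_one).bind fun Q =>
    if Q.card ≤ A.cap then A.out i Q (fun j => w j) else A.overflow i Q

end RelaxedLDC

end

/-! The query decoder serves only to bound `k`. Once `k = O(n ^ (1 - 2γ))`, a Bernoulli sample of
about `n ^ (1 - γ)` coordinates compares `w` with all `2 ^ k` codewords at once, by Chernoff and
union bounds. Searching for a codeword close to `w` on the sample is therefore a relaxed decoder
(`sampleDecoder_spec`), correct on every bit when the distance leaves a gap.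

The bound on `k` is `messageLength_le`. Fix an index and accept when `t` independent runs all output
`1`. Such a test reads at most `Q = t * q` coordinates; its acceptance probability is at least
`(2/3) ^ t` on encodings with bit `1`, and at most `σ = (1/3) ^ t` on every word near an encoding
with bit `0`. This gap has to be seen from a sample of rate `p = n ^ (-β)`, although the views may
share coordinates of high degree that the sample is likely to miss.

So coordinates are layered by degree, measured on a uniformly random word to make the layers
independent of the input. By pigeonhole every accepting view has a level `j` with exactly `j`
coordinates outside the kernel `heavy (j + 1)`, all of them outside the larger set `heavy j`
(`exists_mem_active`). Every assignment to the kernel is tried. The kernel is small enough for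
modified words to stay within the decoding radius, and petal degrees are small enough for a
high-moment bound to beat the number of assignments (`bernProb_flag_le`). For bit `1` a second
moment suffices (`bernProb_not_flag_le`). Each message bit is thus recovered from about `p * n`
coordinates, and counting gives `k = O(p * n)` (`le_of_sample_decoder`). -/

noncomputable section

namespace RelaxedLDC

/-! ### Expectations over Bernoulli subsets -/

/-- The expectation of `h S` for the random subset `S` that contains each coordinate
independently with probability `p`. -/
def bernExp {n : ℕ} (p : ℝ) (h : Finset (Fin n) → ℝ) : ℝ :=
  ∑ S : Finset (Fin n), p ^ S.card * (1 - p) ^ (n - S.card) * h S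

theorem bernExp_mono {n : ℕ} {p : ℝ} (hp : 0 ≤ p) (hp1 : p ≤ 1) {g h : Finset (Fin n) → ℝ}
    (H : ∀ S, g S ≤ h S) : bernExp p g ≤ bernExp p h := by
  have : 0 ≤ 1 - p := by linarith
  exact Finset.sum_le_sum fun S _ => mul_le_mul_of_nonneg_left (H S) (by positivity)

theorem bernExp_sum {n : ℕ} {ι : Type*} (p : ℝ) (s : Finset ι) (h : ι → Finset (Fin n) → ℝ) :
    bernExp p (fun S => ∑ i ∈ s, h i S) = ∑ i ∈ s, bernExp p (h i) := by
  simp only [bernExp, Finset.mul_sum]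
  exact Finset.sum_comm

theorem bernExp_const_mul {n : ℕ} (p a : ℝ) (h : Finset (Fin n) → ℝ) :
    bernExp p (fun S => a * h S) = a * bernExp p h := by
  simp only [bernExp, Finset.mul_sum]
  exact Finset.sum_congr rfl fun S _ => by ring

theorem bernExp_add {n : ℕ} (p : ℝ) (g h : Finset (Fin n) → ℝ) :
    bernExp p (fun S => g S + h S) = bernExp p g + bernExp p h := by
  simp only [bernExp, ← Finset.sum_add_distrib, mul_add]

/-- Independence of the coordinates: expanding the product over `i` yields the sum over subsets.
Containment probabilities and moment generating functions are special cases. -/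
theorem bernExp_prod {n : ℕ} (p : ℝ) (a b : Fin n → ℝ) :
    bernExp p (fun S => (∏ i ∈ S, a i) * ∏ i ∈ Sᶜ, b i) = ∏ i, (p * a i + (1 - p) * b i) := by
  rw [Finset.prod_add, Finset.powerset_univ]
  refine Finset.sum_congr rfl fun S _ => ?_
  rw [Finset.prod_mul_distrib, Finset.prod_mul_distrib, Finset.prod_const, Finset.prod_const,
    ← Finset.compl_eq_univ_sdiff, Finset.card_compl, Fintype.card_fin]
  ring

theorem bernExp_subset {n : ℕ} (p : ℝ) (U : Finset (Fin n)) :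
    bernExp p (fun S => if U ⊆ S then 1 else 0) = p ^ U.card := by
  have h := bernExp_prod p (fun _ : Fin n => 1) (fun i => if i ∈ U then 0 else 1)
  have h1 : ∀ S : Finset (Fin n), (∏ i ∈ S, (1 : ℝ)) * ∏ i ∈ Sᶜ, (if i ∈ U then (0 : ℝ) else 1)
      = if U ⊆ S then 1 else 0 := by
    intro S
    rw [Finset.prod_const_one, one_mul]
    split_ifs with hU
    · refine Finset.prod_eq_one fun i hi => ?_
      rw [if_neg]
      exact fun hiU => Finset.mem_compl.1 hi (hU hiU)
    · obtain ⟨i, hi, hiS⟩ := Finset.not_subset.1 hU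
      exact Finset.prod_eq_zero (Finset.mem_compl.2 hiS) (if_pos hi)
  simp only [h1] at h
  rw [h]
  have h2 : ∀ i : Fin n, p * 1 + (1 - p) * (if i ∈ U then 0 else 1) = if i ∈ U then p else 1 := by
    intro i; split_ifs <;> ring
  simp only [h2]
  rw [Finset.prod_ite, Finset.prod_const_one, mul_one, Finset.prod_const,
    Finset.filter_mem_eq_inter, Finset.univ_inter]

theorem bernExp_pow_inter {n : ℕ} (p l : ℝ) (A : Finset (Fin n)) :
    bernExp p (fun S => l ^ (S ∩ A).card) = (1 - p + p * l) ^ A.card := by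
  have h := bernExp_prod p (fun i : Fin n => if i ∈ A then l else 1) (fun _ => 1)
  have h1 : ∀ S : Finset (Fin n), (∏ i ∈ S, if i ∈ A then l else 1) * ∏ i ∈ Sᶜ, (1 : ℝ)
      = l ^ (S ∩ A).card := by
    intro S
    rw [Finset.prod_const_one, mul_one, Finset.prod_ite, Finset.prod_const_one, mul_one,
      Finset.prod_const, Finset.filter_mem_eq_inter]
  simp only [h1] at h
  rw [h]
  have h2 : ∀ i : Fin n, p * (if i ∈ A then l else 1) + (1 - p) * 1
      = if i ∈ A then 1 - p + p * l else 1 := by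
    intro i; split_ifs <;> ring
  simp only [h2]
  rw [Finset.prod_ite, Finset.prod_const_one, mul_one, Finset.prod_const,
    Finset.filter_mem_eq_inter, Finset.univ_inter]

theorem bernExp_one {n : ℕ} (p : ℝ) : bernExp p (fun _ : Finset (Fin n) => 1) = 1 := by
  simpa using bernExp_subset p (∅ : Finset (Fin n))

theorem bernExp_card {n : ℕ} (p : ℝ) :
    bernExp p (fun S : Finset (Fin n) => (S.card : ℝ)) = p * n := by
  have h : ∀ S : Finset (Fin n), (S.card : ℝ) = ∑ i, if {i} ⊆ S then (1 : ℝ) else 0 := by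
    intro S; simp
  simp only [h]
  rw [bernExp_sum]
  simp only [bernExp_subset]
  simp [mul_comm]

open Classical in
/-- The probability of an event for a Bernoulli subset. -/
def bernProb {n : ℕ} (p : ℝ) (E : Finset (Fin n) → Prop) : ℝ :=
  bernExp p fun S => if E S then 1 else 0

theorem bernProb_le_bernExp {n : ℕ} {p : ℝ} (hp : 0 ≤ p) (hp1 : p ≤ 1)
    {E : Finset (Fin n) → Prop} {h : Finset (Fin n) → ℝ} (h0 : ∀ S, 0 ≤ h S)
    (H : ∀ S, E S → 1 ≤ h S) : bernProb p E ≤ bernExp p h := by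
  refine bernExp_mono hp hp1 fun S => ?_
  split_ifs with hE
  · exact H S hE
  · exact h0 S

theorem bernProb_mono {n : ℕ} {p : ℝ} (hp : 0 ≤ p) (hp1 : p ≤ 1)
    {E F : Finset (Fin n) → Prop} (H : ∀ S, E S → F S) : bernProb p E ≤ bernProb p F :=
  bernProb_le_bernExp hp hp1 (fun S => by split_ifs <;> norm_num) fun S hS => by
    rw [if_pos (H S hS)]

theorem bernProb_exists_le {n : ℕ} {ι : Type*} {p : ℝ} (hp : 0 ≤ p) (hp1 : p ≤ 1)
    (s : Finset ι) (E : ι → Finset (Fin n) → Prop) :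
    bernProb p (fun S => ∃ i ∈ s, E i S) ≤ ∑ i ∈ s, bernProb p (E i) := by
  classical
  simp only [bernProb]
  rw [← bernExp_sum]
  refine bernExp_mono hp hp1 fun S => ?_
  split_ifs with h
  · obtain ⟨i, hi, hE⟩ := h
    have := Finset.single_le_sum (f := fun i => if E i S then (1 : ℝ) else 0)
      (fun i _ => by split_ifs <;> norm_num) hi
    simpa [hE] using this
  · exact Finset.sum_nonneg fun i _ => by split_ifs <;> norm_num

theorem bernProb_or_le {n : ℕ} {p : ℝ} (hp : 0 ≤ p) (hp1 : p ≤ 1)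
    (E F : Finset (Fin n) → Prop) :
    bernProb p (fun S => E S ∨ F S) ≤ bernProb p E + bernProb p F := by
  classical
  simp only [bernProb]
  rw [← bernExp_add]
  refine bernExp_mono hp hp1 fun S => ?_
  by_cases h1 : E S <;> by_cases h2 : F S <;> simp [h1, h2]

theorem bernProb_compl {n : ℕ} (p : ℝ) (E : Finset (Fin n) → Prop) :
    bernProb p E = 1 - bernProb p (fun S => ¬ E S) := by
  classical
  rw [eq_sub_iff_add_eq, ← bernExp_one p (n := n)]
  simp only [bernProb]
  rw [← bernExp_add]
  congr 1
  funext S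
  by_cases h1 : E S <;> simp [h1]

/-! ### Weighted counts of random sets -/

section Moments

variable {n : ℕ} {Ω : Type*}

/-- The total weight of the sets `P ω`, `ω ∈ F`, that are contained in `S`. -/
def coveredWeight (F : Finset Ω) (μ : Ω → ℝ) (P : Ω → Finset (Fin n)) (S : Finset (Fin n)) : ℝ :=
  ∑ ω ∈ F, μ ω * if P ω ⊆ S then 1 else 0

theorem coveredWeight_nonneg {F : Finset Ω} {μ : Ω → ℝ} (hμ : ∀ ω, 0 ≤ μ ω)
    (P : Ω → Finset (Fin n)) (S : Finset (Fin n)) : 0 ≤ coveredWeight F μ P S :=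
  Finset.sum_nonneg fun ω _ => mul_nonneg (hμ ω) (by split_ifs <;> norm_num)

/-- A set disjoint from `U` contributes a full new factor `p ^ j`; a set meeting `U` may contribute
none, but at most weight `d` passes through each point of `U`. -/
theorem sum_mul_pow_card_union_le {p : ℝ} (hp : 0 ≤ p) (hp1 : p ≤ 1) {F : Finset Ω} {μ : Ω → ℝ}
    (hμ : ∀ ω, 0 ≤ μ ω) {P : Ω → Finset (Fin n)} {j : ℕ} (hP : ∀ ω ∈ F, (P ω).card = j) {d : ℝ}
    (hd : ∀ v, ∑ ω ∈ F with v ∈ P ω, μ ω ≤ d) (U : Finset (Fin n)) :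
    ∑ ω ∈ F, μ ω * p ^ (U ∪ P ω).card ≤ p ^ U.card * ((∑ ω ∈ F, μ ω) * p ^ j + U.card * d) := by
  have h1 : ∀ ω ∈ F, μ ω * p ^ (U ∪ P ω).card ≤
      p ^ U.card * (μ ω * p ^ j + ∑ v ∈ U, if v ∈ P ω then μ ω else 0) := by
    intro ω hω
    have hnn : 0 ≤ ∑ v ∈ U, if v ∈ P ω then μ ω else 0 :=
      Finset.sum_nonneg fun v _ => by split_ifs; exacts [hμ ω, le_rfl]
    by_cases hdis : Disjoint U (P ω)
    · rw [Finset.card_union_of_disjoint hdis, hP ω hω, pow_add]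
      have := mul_nonneg (pow_nonneg hp U.card) hnn
      nlinarith
    · obtain ⟨v, hvU, hvP⟩ := Finset.not_disjoint_iff.1 hdis
      have h2 : μ ω ≤ ∑ v ∈ U, if v ∈ P ω then μ ω else 0 := by
        have := Finset.single_le_sum (f := fun v => if v ∈ P ω then μ ω else 0)
          (fun v _ => by split_ifs; exacts [hμ ω, le_rfl]) hvU
        simpa [hvP] using this
      have h3 : p ^ (U ∪ P ω).card ≤ p ^ U.card :=
        pow_le_pow_of_le_one hp hp1 (Finset.card_le_card Finset.subset_union_left)
      calc μ ω * p ^ (U ∪ P ω).card ≤ μ ω * p ^ U.card := mul_le_mul_of_nonneg_left h3 (hμ ω)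
        _ = p ^ U.card * μ ω := mul_comm _ _
        _ ≤ _ := mul_le_mul_of_nonneg_left
          (by have := mul_nonneg (hμ ω) (pow_nonneg hp j); linarith) (pow_nonneg hp _)
  refine (Finset.sum_le_sum h1).trans ?_
  rw [← Finset.mul_sum, Finset.sum_add_distrib, ← Finset.sum_mul, Finset.sum_comm]
  refine mul_le_mul_of_nonneg_left ?_ (pow_nonneg hp _)
  gcongr
  calc ∑ v ∈ U, ∑ ω ∈ F, (if v ∈ P ω then μ ω else 0) ≤ ∑ _v ∈ U, d :=
        Finset.sum_le_sum fun v _ => by rw [← Finset.sum_filter]; exact hd v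
    _ = U.card * d := by simp

/-- Expands the moment one factor at a time, absorbing each chosen `P ω` into `U`. When `r` factors
remain, `U` is a union of `R - r` sets of size `j`, so its collision cost never exceeds `R * j * d`.
-/
theorem bernExp_subset_mul_coveredWeight_pow_le {p : ℝ} (hp : 0 ≤ p) (hp1 : p ≤ 1) {F : Finset Ω}
    {μ : Ω → ℝ} (hμ : ∀ ω, 0 ≤ μ ω) {P : Ω → Finset (Fin n)} {j : ℕ}
    (hP : ∀ ω ∈ F, (P ω).card = j) {d : ℝ} (hd0 : 0 ≤ d)
    (hd : ∀ v, ∑ ω ∈ F with v ∈ P ω, μ ω ≤ d) (R r : ℕ) (hr : r ≤ R) (U : Finset (Fin n))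
    (hU : U.card ≤ j * (R - r)) :
    bernExp p (fun S => (if U ⊆ S then 1 else 0) * coveredWeight F μ P S ^ r) ≤
      p ^ U.card * ((∑ ω ∈ F, μ ω) * p ^ j + R * j * d) ^ r := by
  induction r generalizing U with
  | zero => simpa using (bernExp_subset p U).le
  | succ r ih =>
    have hM : 0 ≤ (∑ ω ∈ F, μ ω) * p ^ j + R * j * d := by
      have := Finset.sum_nonneg fun ω (_ : ω ∈ F) => hμ ω
      positivity
    have h1 : ∀ S : Finset (Fin n), (if U ⊆ S then (1 : ℝ) else 0) * coveredWeight F μ P S ^ (r + 1)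
        = ∑ ω ∈ F, μ ω * ((if U ∪ P ω ⊆ S then 1 else 0) * coveredWeight F μ P S ^ r) := by
      intro S
      rw [pow_succ', coveredWeight, ← mul_assoc, Finset.mul_sum, Finset.sum_mul]
      refine Finset.sum_congr rfl fun ω _ => ?_
      by_cases h1 : U ⊆ S <;> by_cases h2 : P ω ⊆ S <;>
        simp [h1, h2, Finset.union_subset_iff]
    simp only [h1]
    rw [bernExp_sum]
    simp only [bernExp_const_mul]
    have h2 : ∀ ω ∈ F, μ ω * bernExp p (fun S => (if U ∪ P ω ⊆ S then 1 else 0) *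
        coveredWeight F μ P S ^ r) ≤
        μ ω * p ^ (U ∪ P ω).card * ((∑ ω ∈ F, μ ω) * p ^ j + R * j * d) ^ r := by
      intro ω hω
      rw [mul_assoc]
      refine mul_le_mul_of_nonneg_left (ih (by omega) _ ?_) (hμ ω)
      refine (Finset.card_union_le _ _).trans ?_
      rw [hP ω hω]
      have : R - r = (R - (r + 1)) + 1 := by omega
      rw [this, mul_add]
      omega
    refine (Finset.sum_le_sum h2).trans ?_
    rw [← Finset.sum_mul, pow_succ', ← mul_assoc]
    refine mul_le_mul_of_nonneg_right ?_ (pow_nonneg hM r)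
    refine (sum_mul_pow_card_union_le hp hp1 hμ hP hd U).trans ?_
    have hUR : (U.card : ℝ) ≤ R * j := by
      have : U.card ≤ R * j := hU.trans (by rw [mul_comm]; exact Nat.mul_le_mul_right j (by omega))
      exact_mod_cast this
    gcongr

theorem bernExp_coveredWeight_pow_le {p : ℝ} (hp : 0 ≤ p) (hp1 : p ≤ 1) {F : Finset Ω}
    {μ : Ω → ℝ} (hμ : ∀ ω, 0 ≤ μ ω) {P : Ω → Finset (Fin n)} {j : ℕ}
    (hP : ∀ ω ∈ F, (P ω).card = j) {d : ℝ} (hd0 : 0 ≤ d)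
    (hd : ∀ v, ∑ ω ∈ F with v ∈ P ω, μ ω ≤ d) (R : ℕ) :
    bernExp p (fun S => coveredWeight F μ P S ^ R) ≤
      ((∑ ω ∈ F, μ ω) * p ^ j + R * j * d) ^ R := by
  simpa using bernExp_subset_mul_coveredWeight_pow_le hp hp1 hμ hP hd0 hd R R le_rfl ∅ (by simp)

/-- Upper tail bound for the covered weight. -/
theorem bernProb_le_coveredWeight_le {p : ℝ} (hp : 0 < p) (hp1 : p ≤ 1) {F : Finset Ω}
    {μ : Ω → ℝ} (hμ : ∀ ω, 0 ≤ μ ω) {P : Ω → Finset (Fin n)} {j : ℕ}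
    (hP : ∀ ω ∈ F, (P ω).card = j) {d : ℝ} (hd0 : 0 ≤ d)
    (hd : ∀ v, ∑ ω ∈ F with v ∈ P ω, μ ω ≤ d) {σ : ℝ} (hσ0 : 0 < σ) (hσ : ∑ ω ∈ F, μ ω ≤ σ)
    {R : ℕ} (hR : R * j * d ≤ σ * p ^ j) :
    bernProb p (fun S => 4 * σ * p ^ j ≤ coveredWeight F μ P S) ≤ (1 / 2) ^ R := by
  have hs : 0 < 4 * σ * p ^ j := by positivity
  have hN := fun S => coveredWeight_nonneg (F := F) hμ P S
  -- Markov for the `R`-th power: by `hR` the moment is at most `(2 * σ * p ^ j) ^ R`, half the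
  -- threshold in each factor.
  calc bernProb p (fun S => 4 * σ * p ^ j ≤ coveredWeight F μ P S)
      ≤ bernExp p (fun S => ((4 * σ * p ^ j) ^ R)⁻¹ * coveredWeight F μ P S ^ R) := by
        refine bernProb_le_bernExp hp.le hp1 (fun S => ?_) fun S hS => ?_
        · have := hN S
          positivity
        · rw [← div_eq_inv_mul, one_le_div (by positivity)]
          gcongr
    _ = ((4 * σ * p ^ j) ^ R)⁻¹ * bernExp p (fun S => coveredWeight F μ P S ^ R) :=
        bernExp_const_mul _ _ _
    _ ≤ ((4 * σ * p ^ j) ^ R)⁻¹ * (2 * σ * p ^ j) ^ R := by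
        gcongr
        refine (bernExp_coveredWeight_pow_le hp.le hp1 hμ hP hd0 hd R).trans ?_
        have h0 : 0 ≤ ∑ ω ∈ F, μ ω := Finset.sum_nonneg fun ω _ => hμ ω
        gcongr
        have : (∑ ω ∈ F, μ ω) * p ^ j ≤ σ * p ^ j := by gcongr
        linarith
    _ = (1 / 2) ^ R := by
        rw [← div_eq_inv_mul, ← div_pow]
        congr 1
        field_simp
        norm_num

theorem bernExp_coveredWeight {p : ℝ} {F : Finset Ω} {μ : Ω → ℝ} {P : Ω → Finset (Fin n)} {j : ℕ}
    (hP : ∀ ω ∈ F, (P ω).card = j) :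
    bernExp p (coveredWeight F μ P) = (∑ ω ∈ F, μ ω) * p ^ j := by
  have : coveredWeight F μ P = fun S => ∑ ω ∈ F, μ ω * if P ω ⊆ S then 1 else 0 := rfl
  rw [this, bernExp_sum, Finset.sum_mul]
  refine Finset.sum_congr rfl fun ω hω => ?_
  rw [bernExp_const_mul, bernExp_subset, hP ω hω]

/-- Lower tail bound for the covered weight, by the second moment method. -/
theorem bernProb_coveredWeight_lt_le {p : ℝ} (hp : 0 < p) (hp1 : p ≤ 1) {F : Finset Ω}
    {μ : Ω → ℝ} (hμ : ∀ ω, 0 ≤ μ ω) {P : Ω → Finset (Fin n)} {j : ℕ}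
    (hP : ∀ ω ∈ F, (P ω).card = j) {d : ℝ}
    (hd : ∀ v, ∑ ω ∈ F with v ∈ P ω, μ ω ≤ d) (hF : 0 < ∑ ω ∈ F, μ ω) :
    bernProb p (fun S => coveredWeight F μ P S < (∑ ω ∈ F, μ ω) * p ^ j / 2) ≤
      4 * j * d / ((∑ ω ∈ F, μ ω) * p ^ j) := by
  set M := (∑ ω ∈ F, μ ω) * p ^ j with hM
  have hM0 : 0 < M := by positivity
  have h2 : bernExp p (fun S => coveredWeight F μ P S ^ 2) ≤ M ^ 2 + M * (j * d) := by
    have e : ∀ S, coveredWeight F μ P S ^ 2 = ∑ ω ∈ F, ∑ ω' ∈ F, μ ω * (μ ω' *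
        if P ω ∪ P ω' ⊆ S then 1 else 0) := by
      intro S
      rw [pow_two, coveredWeight, Finset.sum_mul_sum]
      refine Finset.sum_congr rfl fun ω _ => Finset.sum_congr rfl fun ω' _ => ?_
      by_cases h1 : P ω ⊆ S <;> by_cases h2 : P ω' ⊆ S <;>
        simp [h1, h2, Finset.union_subset_iff]
    simp only [e, bernExp_sum, bernExp_const_mul, bernExp_subset]
    have h3 : ∀ ω ∈ F, ∑ ω' ∈ F, μ ω * (μ ω' * p ^ (P ω ∪ P ω').card) ≤
        μ ω * (p ^ j * (M + j * d)) := by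
      intro ω hω
      rw [← Finset.mul_sum]
      refine mul_le_mul_of_nonneg_left ?_ (hμ ω)
      have := sum_mul_pow_card_union_le hp.le hp1 hμ hP hd (P ω)
      rwa [hP ω hω] at this
    refine (Finset.sum_le_sum h3).trans ?_
    rw [← Finset.sum_mul, ← mul_assoc, ← hM]
    exact le_of_eq (by ring)
  have hvar : bernExp p (fun S => (coveredWeight F μ P S - M) ^ 2) ≤ M * (j * d) := by
    have e : ∀ S, (coveredWeight F μ P S - M) ^ 2 =
        coveredWeight F μ P S ^ 2 + ((-2 * M) * coveredWeight F μ P S + M ^ 2 * 1) := by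
      intro S; ring
    simp only [e]
    rw [bernExp_add, bernExp_add, bernExp_const_mul, bernExp_const_mul, bernExp_one,
      bernExp_coveredWeight hP, ← hM]
    linarith
  calc bernProb p (fun S => coveredWeight F μ P S < M / 2)
      ≤ bernExp p (fun S => (4 / M ^ 2) * (coveredWeight F μ P S - M) ^ 2) := by
        refine bernProb_le_bernExp hp.le hp1 (fun S => by positivity) fun S hS => ?_
        rw [div_mul_eq_mul_div, one_le_div (by positivity)]
        nlinarith
    _ = 4 / M ^ 2 * bernExp p (fun S => (coveredWeight F μ P S - M) ^ 2) :=
        bernExp_const_mul _ _ _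
    _ ≤ 4 / M ^ 2 * (M * (j * d)) := by gcongr
    _ = 4 * j * d / M := by field_simp

end Moments

/-! ### Weighted families of local views -/

theorem card_agree_mul {n : ℕ} (A : Finset (Fin n)) (w : Word n) :
    (Finset.univ.filter fun w' : Word n => ∀ v ∈ A, w' v = w v).card * 2 ^ A.card = 2 ^ n := by
  have h : (Finset.univ.filter fun w' : Word n => ∀ v ∈ A, w' v = w v) =
      Fintype.piFinset fun v => if v ∈ A then {w v} else Finset.univ := by
    ext w'
    simp only [Finset.mem_filter, Finset.mem_univ, true_and, Fintype.mem_piFinset]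
    refine forall_congr' fun v => ?_
    split_ifs with hv <;> simp [hv]
  have h2 : ∀ v, (if v ∈ A then {w v} else Finset.univ : Finset Bool).card
      = if v ∈ A then 1 else 2 := by
    intro v; split_ifs <;> simp
  rw [h, Fintype.card_piFinset]
  simp only [h2]
  rw [Finset.prod_ite, Finset.prod_const_one, one_mul, Finset.prod_const, ← pow_add]
  congr 1
  rw [Finset.filter_not, Finset.filter_mem_eq_inter, Finset.univ_inter,
    Finset.card_sdiff_add_card_eq_card (Finset.subset_univ A), Finset.card_univ, Fintype.card_fin]

/-- A weighted family of adaptive local tests: on the word `w` the test `ω` reads the coordinates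
in `supp ω w`, at most `Q` many, and accepts if `acc ω w`. -/
structure LocalViews (n Q : ℕ) (Ω : Type*) [Fintype Ω] where
  μ : Ω → ℝ
  μ_nonneg : ∀ ω, 0 ≤ μ ω
  sum_μ_le : ∑ ω, μ ω ≤ 1
  supp : Ω → Word n → Finset (Fin n)
  card_supp_le : ∀ ω w, (supp ω w).card ≤ Q
  acc : Ω → Word n → Bool
  supp_congr : ∀ ω w w', (∀ v ∈ supp ω w, w' v = w v) → supp ω w' = supp ω w
  acc_congr : ∀ ω w w', (∀ v ∈ supp ω w, w' v = w v) → acc ω w' = acc ω w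

namespace LocalViews

variable {n Q : ℕ} {Ω : Type*} [Fintype Ω] (V : LocalViews n Q Ω)

/-- The total weight of the tests that accept `w`. -/
def accWeight (w : Word n) : ℝ := ∑ ω with V.acc ω w, V.μ ω

/-- The weight of the tests that read `v` on a uniformly random word. -/
def deg (v : Fin n) : ℝ := (∑ w : Word n, ∑ ω with v ∈ V.supp ω w, V.μ ω) / 2 ^ n

theorem deg_nonneg (v : Fin n) : 0 ≤ V.deg v :=
  div_nonneg (Finset.sum_nonneg fun _ _ => Finset.sum_nonneg fun ω _ => V.μ_nonneg ω) (by positivity)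

/-- Double counting, word by word. It is what makes the heavy sets small. -/
theorem sum_deg_le : ∑ v, V.deg v ≤ Q := by
  simp only [deg]
  rw [← Finset.sum_div, div_le_iff₀ (by positivity), Finset.sum_comm]
  have h : ∀ w : Word n, ∑ v, ∑ ω with v ∈ V.supp ω w, V.μ ω ≤ Q := by
    intro w
    simp only [Finset.sum_filter]
    rw [Finset.sum_comm]
    calc ∑ ω, ∑ v, (if v ∈ V.supp ω w then V.μ ω else 0)
        = ∑ ω, (V.supp ω w).card * V.μ ω := by simp
      _ ≤ ∑ ω, Q * V.μ ω := Finset.sum_le_sum fun ω _ => mul_le_mul_of_nonneg_right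
          (by exact_mod_cast V.card_supp_le ω w) (V.μ_nonneg ω)
      _ = Q * ∑ ω, V.μ ω := (Finset.mul_sum _ _ _).symm
      _ ≤ Q * 1 := by have := V.sum_μ_le; gcongr
      _ = Q := mul_one _
  calc ∑ w : Word n, ∑ v, ∑ ω with v ∈ V.supp ω w, V.μ ω ≤ ∑ _w : Word n, (Q : ℝ) :=
        Finset.sum_le_sum fun w _ => h w
    _ = Q * 2 ^ n := by simp [mul_comm]

/-- A test that reads `v` on a given word does so on a `2 ^ (-Q)` fraction of all words. -/
theorem sum_mem_supp_le (w : Word n) (v : Fin n) :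
    ∑ ω with v ∈ V.supp ω w, V.μ ω ≤ 2 ^ Q * V.deg v := by
  rw [deg, ← mul_div_assoc, le_div_iff₀ (by positivity), Finset.sum_mul, Finset.sum_filter]
  simp only [Finset.sum_filter]
  rw [Finset.sum_comm, Finset.mul_sum]
  refine Finset.sum_le_sum fun ω _ => ?_
  split_ifs with hv
  · set B := Finset.univ.filter fun w' : Word n => ∀ v ∈ V.supp ω w, w' v = w v
    have h1 : (B.card : ℝ) * V.μ ω ≤ ∑ w', if v ∈ V.supp ω w' then V.μ ω else 0 := by
      calc (B.card : ℝ) * V.μ ω = ∑ w' ∈ B, V.μ ω := by simp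
        _ = ∑ w' ∈ B, if v ∈ V.supp ω w' then V.μ ω else 0 := by
            refine Finset.sum_congr rfl fun w' hw' => ?_
            rw [V.supp_congr ω w w' (Finset.mem_filter.1 hw').2, if_pos hv]
        _ ≤ _ := Finset.sum_le_sum_of_subset_of_nonneg (Finset.subset_univ _) fun w' _ _ => by
            split_ifs; exacts [V.μ_nonneg ω, le_rfl]
    have h2 : (2 : ℝ) ^ n ≤ 2 ^ Q * B.card := by
      have : B.card * 2 ^ (V.supp ω w).card = 2 ^ n := card_agree_mul _ w
      have h3 : 2 ^ n ≤ 2 ^ Q * B.card := by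
        rw [← this, mul_comm]
        exact Nat.mul_le_mul_right _ (Nat.pow_le_pow_right two_pos (V.card_supp_le ω w))
      exact_mod_cast h3
    calc V.μ ω * 2 ^ n ≤ V.μ ω * (2 ^ Q * B.card) := mul_le_mul_of_nonneg_left h2 (V.μ_nonneg ω)
      _ = 2 ^ Q * (B.card * V.μ ω) := by ring
      _ ≤ _ := by gcongr
  · exact mul_nonneg (by positivity)
      (Finset.sum_nonneg fun _ _ => by split_ifs; exacts [V.μ_nonneg ω, le_rfl])

/-! ### Layering coordinates by degree: kernels and petals -/

variable (D : ℕ → ℝ)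

/-- The coordinates whose degree is at least the `j`-th threshold. -/
def heavy (j : ℕ) : Finset (Fin n) := Finset.univ.filter fun v => D j ≤ V.deg v

theorem heavy_anti (hD : Monotone D) {i j : ℕ} (h : i ≤ j) : V.heavy D j ⊆ V.heavy D i := by
  intro v hv
  simp only [heavy, Finset.mem_filter, Finset.mem_univ, true_and] at hv ⊢
  exact (hD h).trans hv

theorem card_heavy_mul_le (j : ℕ) : (V.heavy D j).card * D j ≤ Q := by
  calc (V.heavy D j).card * D j = ∑ v ∈ V.heavy D j, D j := by simp
    _ ≤ ∑ v ∈ V.heavy D j, V.deg v := Finset.sum_le_sum fun v hv => (Finset.mem_filter.1 hv).2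
    _ ≤ ∑ v, V.deg v := Finset.sum_le_sum_of_subset_of_nonneg (Finset.subset_univ _)
        fun v _ _ => V.deg_nonneg v
    _ ≤ Q := V.sum_deg_le

/-- The part of the view outside the kernel `heavy (j + 1)`. -/
def petal (j : ℕ) (w : Word n) (ω : Ω) : Finset (Fin n) := V.supp ω w \ V.heavy D (j + 1)

/-- The accepting tests whose views have exactly `j` coordinates outside `heavy j`, none of
which is in `heavy j` but not in `heavy (j + 1)`. -/
def active (j : ℕ) (w : Word n) : Finset Ω :=
  Finset.univ.filter fun ω => V.acc ω w ∧ (V.supp ω w \ V.heavy D j).card = j ∧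
    (V.petal D j w ω).card = j

/-- The number `f j` of view coordinates outside `heavy j` is nondecreasing and at most `Q`. For the
first `j` with `f (j + 1) ≤ j`, minimality gives `j ≤ f j`, so `f j = f (j + 1) = j`. -/
theorem exists_mem_active (hD : Monotone D) {w : Word n} {ω : Ω}
    (h : V.acc ω w) : ∃ j ∈ Finset.range (Q + 1), ω ∈ V.active D j w := by
  classical
  set f : ℕ → ℕ := fun j => (V.supp ω w \ V.heavy D j).card with hf
  have hmono : ∀ j, f j ≤ f (j + 1) := fun j =>
    Finset.card_le_card (Finset.sdiff_subset_sdiff le_rfl (V.heavy_anti D hD (Nat.le_succ j)))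
  have hQ : ∀ j, f j ≤ Q := fun j =>
    (Finset.card_le_card Finset.sdiff_subset).trans (V.card_supp_le ω w)
  have hex : ∃ j, f (j + 1) < j + 1 := ⟨Q, Nat.lt_succ_of_le (hQ _)⟩
  have hmin : ∀ m < Nat.find hex, ¬ f (m + 1) < m + 1 := fun m hm => Nat.find_min hex hm
  have hspec := Nat.find_spec hex
  have hle : Nat.find hex ≤ Q := Nat.find_min' hex (Nat.lt_succ_of_le (hQ _))
  set j := Nat.find hex
  have hge : j ≤ f j := by
    rcases Nat.eq_zero_or_pos j with h0 | h0
    · rw [h0]; exact Nat.zero_le _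
    · have := hmin (j - 1) (by omega)
      rw [Nat.sub_add_cancel h0] at this
      omega
  refine ⟨j, Finset.mem_range.2 (by omega), Finset.mem_filter.2 ⟨Finset.mem_univ _, h, ?_, ?_⟩⟩
  · have := hmono j; change f j = j; omega
  · have := hmono j; change f (j + 1) = j; omega

/-- For active tests the petal equals the view minus `heavy j`, as these sets are nested and equally
large. Hence the degree bound is `D j` rather than `D (j + 1)`; this gain of one level pays for the
kernel assignments. -/
theorem sum_active_petal_le (hD : Monotone D) (hD0 : D 0 = 0) (j : ℕ) (w : Word n) (v : Fin n) :
    ∑ ω ∈ V.active D j w with v ∈ V.petal D j w ω, V.μ ω ≤ 2 ^ Q * D j := by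
  have hDj : 0 ≤ D j := hD0 ▸ hD (Nat.zero_le j)
  have hsub : ∀ ω ∈ V.active D j w, V.petal D j w ω = V.supp ω w \ V.heavy D j := by
    intro ω hω
    obtain ⟨-, -, h1, h2⟩ := Finset.mem_filter.1 hω
    exact (Finset.eq_of_subset_of_card_le
      (Finset.sdiff_subset_sdiff le_rfl (V.heavy_anti D hD (Nat.le_succ j))) (by
        rw [h1]; exact h2.le)).symm
  by_cases hv : v ∈ V.heavy D j
  · rw [Finset.filter_false_of_mem, Finset.sum_empty]
    · positivity
    · intro ω hω
      rw [hsub ω hω]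
      exact fun h => (Finset.mem_sdiff.1 h).2 hv
  · have hdeg : V.deg v ≤ D j := by
      simp only [heavy, Finset.mem_filter, Finset.mem_univ, true_and, not_le] at hv
      exact hv.le
    calc ∑ ω ∈ V.active D j w with v ∈ V.petal D j w ω, V.μ ω ≤ ∑ ω with v ∈ V.supp ω w, V.μ ω := by
          refine Finset.sum_le_sum_of_subset_of_nonneg (fun ω hω => ?_) fun ω _ _ => V.μ_nonneg ω
          exact Finset.mem_filter.2 ⟨Finset.mem_univ _,
            (Finset.mem_sdiff.1 (Finset.mem_filter.1 hω).2).1⟩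
      _ ≤ 2 ^ Q * V.deg v := V.sum_mem_supp_le w v
      _ ≤ 2 ^ Q * D j := by gcongr

/-- The words that agree with `w` outside `heavy (j + 1)`. -/
def variants (j : ℕ) (w : Word n) : Finset (Word n) :=
  Finset.univ.filter fun w' => ∀ v ∈ (V.heavy D (j + 1))ᶜ, w' v = w v

theorem card_variants (j : ℕ) (w : Word n) :
    (V.variants D j w).card = 2 ^ (V.heavy D (j + 1)).card := by
  have h := card_agree_mul (V.heavy D (j + 1))ᶜ w
  have h2 := Finset.card_add_card_compl (V.heavy D (j + 1))
  rw [Fintype.card_fin] at h2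
  refine Nat.eq_of_mul_eq_mul_right (Nat.two_pow_pos (V.heavy D (j + 1))ᶜ.card) ?_
  rw [← pow_add, h2]
  exact h

/-- The sample `S` of `w` supports acceptance: for some level `j` and some assignment to the kernel
`heavy (j + 1)`, many active tests have their petals inside `S`. -/
def Flag (p σ : ℝ) (S : Finset (Fin n)) (w : Word n) : Prop :=
  ∃ j ∈ Finset.range (Q + 1), ∃ w' ∈ V.variants D j w,
    4 * σ * p ^ j ≤ coveredWeight (V.active D j w') V.μ (V.petal D j w') S

/-- A test whose petal lies in `S` reads only `S` and the kernel, and all kernel assignments are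
tried; so the flag is computable from the sample. -/
theorem flag_of_agree {p σ : ℝ} {S : Finset (Fin n)} {w₁ w₂ : Word n}
    (h : ∀ v ∈ S, w₁ v = w₂ v) (hf : V.Flag D p σ S w₁) : V.Flag D p σ S w₂ := by
  obtain ⟨j, hj, w', hw', hN⟩ := hf
  simp only [variants, Finset.mem_filter, Finset.mem_univ, true_and, Finset.mem_compl] at hw'
  -- The kernel assignment of the witness `w'` is transplanted into `w₂`.
  set w'' : Word n := fun v => if v ∈ V.heavy D (j + 1) then w' v else w₂ v with hw''
  have hagree : ∀ v, v ∈ V.heavy D (j + 1) ∨ v ∈ S → w'' v = w' v := by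
    intro v hv
    simp only [hw'']
    split_ifs with h1
    · rfl
    · rw [hw' v h1, h v (hv.resolve_left h1)]
  refine ⟨j, hj, w'', ?_, hN.trans ?_⟩
  · simp only [variants, Finset.mem_filter, Finset.mem_univ, true_and, Finset.mem_compl]
    intro v hv
    simp [hw'', hv]
  · simp only [coveredWeight, mul_ite, mul_one, mul_zero]
    rw [← Finset.sum_filter, ← Finset.sum_filter]
    refine Finset.sum_le_sum_of_subset_of_nonneg (fun ω hω => ?_) fun ω _ _ => V.μ_nonneg ω
    obtain ⟨h1, h2⟩ := Finset.mem_filter.1 hω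
    obtain ⟨-, h3, h4, h5⟩ := Finset.mem_filter.1 h1
    have hag : ∀ v ∈ V.supp ω w', w'' v = w' v := by
      intro v hv
      refine hagree v ?_
      by_cases hvh : v ∈ V.heavy D (j + 1)
      · exact Or.inl hvh
      · exact Or.inr (h2 (Finset.mem_sdiff.2 ⟨hv, hvh⟩))
    have hs := V.supp_congr ω w' w'' hag
    have hpet : V.petal D j w'' ω = V.petal D j w' ω := by rw [petal, petal, hs]
    refine Finset.mem_filter.2 ⟨Finset.mem_filter.2 ⟨Finset.mem_univ _, ?_, ?_, ?_⟩, ?_⟩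
    · rw [V.acc_congr ω w' w'' hag, h3]
    · rw [hs, h4]
    · rw [hpet, h5]
    · rw [hpet]; exact h2

theorem sum_active_le (j : ℕ) (w : Word n) : ∑ ω ∈ V.active D j w, V.μ ω ≤ V.accWeight w := by
  refine Finset.sum_le_sum_of_subset_of_nonneg (fun ω hω => ?_) fun ω _ _ => V.μ_nonneg ω
  exact Finset.mem_filter.2 ⟨Finset.mem_univ _, (Finset.mem_filter.1 hω).2.1⟩

/-- The moment order `(heavy (j + 1)).card + a` gives each assignment failure probability small
enough for a union bound over all `2 ^ (heavy (j + 1)).card` of them, with `(1 / 2) ^ a` left over.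
-/
theorem bernProb_flag_le (hD : Monotone D) (hD0 : D 0 = 0) {p σ : ℝ} (hp : 0 < p) (hp1 : p ≤ 1)
    (hσ : 0 < σ) {a : ℕ}
    (ha : ∀ j ≤ Q, (((V.heavy D (j + 1)).card + a : ℕ) : ℝ) * j * (2 ^ Q * D j) ≤ σ * p ^ j)
    {w : Word n} (hw : ∀ j ≤ Q, ∀ w' ∈ V.variants D j w, V.accWeight w' ≤ σ) :
    bernProb p (fun S => V.Flag D p σ S w) ≤ (Q + 1) * (1 / 2) ^ a := by
  have h1 : ∀ j ∈ Finset.range (Q + 1), bernProb p (fun S => ∃ w' ∈ V.variants D j w,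
      4 * σ * p ^ j ≤ coveredWeight (V.active D j w') V.μ (V.petal D j w') S) ≤ (1 / 2) ^ a := by
    intro j hj
    have hjQ : j ≤ Q := Nat.lt_succ_iff.1 (Finset.mem_range.1 hj)
    refine (bernProb_exists_le hp.le hp1 _ _).trans ?_
    have h2 : ∀ w' ∈ V.variants D j w, bernProb p (fun S =>
        4 * σ * p ^ j ≤ coveredWeight (V.active D j w') V.μ (V.petal D j w') S) ≤
        (1 / 2) ^ ((V.heavy D (j + 1)).card + a) := by
      intro w' hw'
      refine bernProb_le_coveredWeight_le hp hp1 V.μ_nonneg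
        (fun ω hω => (Finset.mem_filter.1 hω).2.2.2) ?_ (V.sum_active_petal_le D hD hD0 j w')
        hσ ((V.sum_active_le D j w').trans (hw j hjQ w' hw')) (ha j hjQ)
      have : 0 ≤ D j := hD0 ▸ hD (Nat.zero_le j)
      positivity
    refine (Finset.sum_le_sum h2).trans ?_
    rw [Finset.sum_const, card_variants, nsmul_eq_mul, pow_add, ← mul_assoc]
    refine le_of_eq ?_
    push_cast
    rw [← mul_pow]
    norm_num
  refine (bernProb_exists_le hp.le hp1 _ _).trans ((Finset.sum_le_sum h1).trans ?_)
  simp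

/-- One of the `Q + 1` levels carries weight at least `8 * σ`, so the flag threshold is at most half
its mean. Only the unmodified `w` is needed as witness, hence Chebyshev is enough. -/
theorem bernProb_not_flag_le (hD : Monotone D) (hD0 : D 0 = 0) {p σ : ℝ} (hp : 0 < p)
    (hp1 : p ≤ 1) (hσ : 0 < σ) {a : ℕ} (ha0 : 0 < a)
    (ha : ∀ j ≤ Q, (((V.heavy D (j + 1)).card + a : ℕ) : ℝ) * j * (2 ^ Q * D j) ≤ σ * p ^ j)
    {w : Word n} (hw : (Q + 1) * (8 * σ) ≤ V.accWeight w) :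
    bernProb p (fun S => ¬ V.Flag D p σ S w) ≤ 1 / (2 * a) := by
  obtain ⟨j, hj, hjw⟩ : ∃ j ∈ Finset.range (Q + 1), 8 * σ ≤ ∑ ω ∈ V.active D j w, V.μ ω := by
    by_contra! hcon
    have h1 : V.accWeight w ≤ ∑ j ∈ Finset.range (Q + 1), ∑ ω ∈ V.active D j w, V.μ ω := by
      classical
      have e : ∀ j, ∑ ω ∈ V.active D j w, V.μ ω = ∑ ω, if ω ∈ V.active D j w then V.μ ω else 0 := by
        intro j; simp
      simp only [e]
      rw [accWeight, Finset.sum_filter, Finset.sum_comm]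
      refine Finset.sum_le_sum fun ω _ => ?_
      have hnn : ∀ j ∈ Finset.range (Q + 1), 0 ≤ if ω ∈ V.active D j w then V.μ ω else 0 :=
        fun j _ => by split_ifs; exacts [V.μ_nonneg ω, le_rfl]
      split_ifs with hacc
      · obtain ⟨j, hj, hjω⟩ := V.exists_mem_active D hD hacc
        have := Finset.single_le_sum hnn hj
        rwa [if_pos hjω] at this
      · exact Finset.sum_nonneg hnn
    have h2 := Finset.sum_lt_sum_of_nonempty (Finset.nonempty_range_iff.2 (Nat.succ_ne_zero Q)) hcon
    simp only [Finset.sum_const, Finset.card_range, nsmul_eq_mul] at h2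
    push_cast at h2
    linarith
  have hjQ : j ≤ Q := Nat.lt_succ_iff.1 (Finset.mem_range.1 hj)
  have hpos : 0 < ∑ ω ∈ V.active D j w, V.μ ω := by linarith
  have hDj : 0 ≤ D j := hD0 ▸ hD (Nat.zero_le j)
  have hlow := bernProb_coveredWeight_lt_le hp hp1 V.μ_nonneg
    (fun ω hω => (Finset.mem_filter.1 hω).2.2.2) (V.sum_active_petal_le D hD hD0 j w) hpos
  refine (bernProb_mono hp.le hp1 fun S hS => ?_).trans (hlow.trans ?_)
  · by_contra! hcon
    refine hS ⟨j, hj, w, Finset.mem_filter.2 ⟨Finset.mem_univ _, fun _ _ => rfl⟩, le_trans ?_ hcon⟩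
    have := mul_le_mul_of_nonneg_right hjw (pow_nonneg hp.le j)
    linarith
  · have h1 : (a : ℝ) * j * (2 ^ Q * D j) ≤ σ * p ^ j := by
      refine le_trans ?_ (ha j hjQ)
      gcongr
      omega
    have ha' : (0 : ℝ) < a := by exact_mod_cast ha0
    have hpj : 0 < p ^ j := pow_pos hp j
    rw [div_le_div_iff₀ (by positivity) (by positivity)]
    have := mul_le_mul_of_nonneg_right hjw hpj.le
    linarith

end LocalViews

/-! ### Local views of a query algorithm -/

namespace DecisionTree

/-- The set of coordinates that the tree queries on the string `w`. -/
def queried {n : ℕ} (w : Word n) : DecisionTree n → Finset (Fin n)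
  | leaf _ => ∅
  | query j next => insert j (queried w (next (w j)))

theorem card_queried_le {n : ℕ} (w : Word n) (T : DecisionTree n) :
    (T.queried w).card ≤ T.numQueries w := by
  induction T with
  | leaf b => simp [queried]
  | query j next ih =>
    simp only [queried, numQueries]
    exact (Finset.card_insert_le _ _).trans (Nat.succ_le_succ (ih _))

theorem congr_of_agree {n : ℕ} {w w' : Word n} (T : DecisionTree n)
    (h : ∀ v ∈ T.queried w, w' v = w v) :
    T.queried w' = T.queried w ∧ T.eval w' = T.eval w := by
  induction T with
  | leaf b => simp [queried, eval]
  | query j next ih =>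
    simp only [queried, Finset.mem_insert, forall_eq_or_imp] at h
    obtain ⟨h1, h2⟩ := ih (w j) h.2
    simp only [queried, eval, h.1, h1, h2, and_self]

end DecisionTree

/-- A `q`-query test on words of length `n`: the coordinates read and the verdict, as functions
of the word. -/
structure LocalTest (n q : ℕ) where
  view : Word n → Finset (Fin n) × Bool
  card_le : ∀ w, (view w).1.card ≤ q
  congr : ∀ w w', (∀ v ∈ (view w).1, w' v = w v) → view w' = view w

/-- Decision trees may repeat queries and form an infinite type; their input-output behaviours do
not, so acceptance weights become finite sums. -/
instance (n q : ℕ) : Finite (LocalTest n q) :=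
  Finite.of_injective LocalTest.view fun f g h => by
    cases f; cases g; congr

instance (n q : ℕ) : Fintype (LocalTest n q) := Fintype.ofFinite _

open Classical in
/-- The test whether a decision tree outputs `1`. -/
def DecisionTree.toTest {n : ℕ} (q : ℕ) (T : DecisionTree n) : LocalTest n q :=
  if h : ∀ w, T.numQueries w ≤ q then
    { view := fun w => (T.queried w, decide (T.eval w = some true))
      card_le := fun w => (T.card_queried_le w).trans (h w)
      congr := fun w w' hw => by
        obtain ⟨h1, h2⟩ := T.congr_of_agree hw
        simp only [h1, h2] }
  -- A dummy for trees that query too much; these lie outside the support of a `q`-query algorithm.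
  else
    { view := fun _ => (∅, false)
      card_le := fun _ => by simp
      congr := fun _ _ _ => rfl }

/-- The `t`-fold conjunction of independent tests drawn from `P`. -/
def testViews {n q : ℕ} (P : PMF (LocalTest n q)) (t : ℕ) :
    LocalViews n (t * q) (Fin t → LocalTest n q) where
  μ ω := ∏ a, (P (ω a)).toReal
  μ_nonneg ω := Finset.prod_nonneg fun _ _ => ENNReal.toReal_nonneg
  sum_μ_le := by
    have h : ∑ f, P f = 1 := by rw [← P.tsum_coe, tsum_fintype]
    rw [← Fintype.sum_pow fun f => (P f).toReal, ← ENNReal.toReal_sum fun f _ => P.apply_ne_top f, h]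
    simp
  supp ω w := Finset.univ.biUnion fun a => ((ω a).view w).1
  card_supp_le ω w := by
    refine Finset.card_biUnion_le.trans ?_
    calc ∑ a, ((ω a).view w).1.card ≤ ∑ _a : Fin t, q := Finset.sum_le_sum fun a _ => (ω a).card_le w
      _ = t * q := by simp
  acc ω w := decide (∀ a, ((ω a).view w).2 = true)
  supp_congr ω w w' h := by
    have : ∀ a, (ω a).view w' = (ω a).view w := fun a => (ω a).congr w w' fun v hv =>
      h v (Finset.mem_biUnion.2 ⟨a, Finset.mem_univ a, hv⟩)
    simp only [this]
  acc_congr ω w w' h := by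
    have : ∀ a, (ω a).view w' = (ω a).view w := fun a => (ω a).congr w w' fun v hv =>
      h v (Finset.mem_biUnion.2 ⟨a, Finset.mem_univ a, hv⟩)
    simp only [this]

theorem accWeight_testViews {n q : ℕ} (P : PMF (LocalTest n q)) (t : ℕ) (w : Word n) :
    (testViews P t).accWeight w = (P.toOuterMeasure {f | (f.view w).2 = true}).toReal ^ t := by
  rw [PMF.toOuterMeasure_apply_fintype, ENNReal.toReal_sum, Fintype.sum_pow,
    LocalViews.accWeight, Finset.sum_filter]
  · refine Finset.sum_congr rfl fun ω _ => ?_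
    have : ∀ a, (Set.indicator {f : LocalTest n q | (f.view w).2 = true} P (ω a)).toReal =
        if ((ω a).view w).2 = true then (P (ω a)).toReal else 0 := by
      intro a
      rw [Set.indicator_apply]
      simp only [Set.mem_ofPred_eq]
      split_ifs <;> simp
    simp only [this]
    rw [Finset.prod_ite_zero]
    simp [testViews]
  · intro f _
    rw [Set.indicator_apply]
    split_ifs
    · exact P.apply_ne_top f
    · simp

/-- The views of `t` independent runs on index `i`. -/
def QueryAlgorithm.views {k n : ℕ} (D : QueryAlgorithm k n) (q t : ℕ) (i : Fin k) :
    LocalViews n (t * q) (Fin t → LocalTest n q) :=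
  testViews ((D.tree i).map (DecisionTree.toTest q)) t

theorem QueryAlgorithm.accWeight_views {k n : ℕ} {D : QueryAlgorithm k n} {q : ℕ}
    (hD : D.QueryComplexityLE q) (t : ℕ) (i : Fin k) (w : Word n) :
    (D.views q t i).accWeight w = (D.run i w (some true)).toReal ^ t := by
  rw [QueryAlgorithm.views, accWeight_testViews, PMF.toOuterMeasure_map_apply, QueryAlgorithm.run,
    ← PMF.toOuterMeasure_apply_singleton, PMF.toOuterMeasure_map_apply]
  congr 2
  -- `toTest` is faithful only where the query bound holds, so the events are compared on the
  -- support.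
  refine PMF.toOuterMeasure_apply_eq_of_inter_support_eq _ ?_
  ext T
  simp only [Set.mem_inter_iff, Set.mem_preimage, Set.mem_ofPred_eq, Set.mem_singleton_iff]
  refine and_congr_left fun hT => ?_
  rw [DecisionTree.toTest, dif_pos (hD i T hT)]
  simp

theorem IsRelaxedDecoder.two_thirds_le {k n : ℕ} {C : Word k → Word n} {δ : ℝ}
    {run : Fin k → Word n → PMF (Option Bool)} (h : IsRelaxedDecoder C δ run) (i : Fin k)
    (x : Word k) : 2 / 3 ≤ (run i (C x) (some (x i))).toReal := by
  have := ENNReal.toReal_mono (PMF.apply_ne_top _ _) (h.completeness i x)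
  simpa using this

/-- The outputs `0` and `⊥` already take mass `2/3`. Counting `⊥` as rejection is what gives
soundness on corrupted words. -/
theorem IsRelaxedDecoder.le_one_third {k n : ℕ} {C : Word k → Word n} {δ : ℝ}
    {run : Fin k → Word n → PMF (Option Bool)} (h : IsRelaxedDecoder C δ run) {i : Fin k}
    {w : Word n} {x : Word k} (hw : relDist w (C x) ≤ δ) (hx : x i = false) :
    (run i w (some true)).toReal ≤ 1 / 3 := by
  have h1 := ENNReal.toReal_mono (by simp [PMF.apply_ne_top]) (h.relaxed_decoding i w x hw)
  rw [ENNReal.toReal_add (PMF.apply_ne_top _ _) (PMF.apply_ne_top _ _), hx] at h1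
  have h2 := (run i w).tsum_coe
  rw [tsum_fintype, Fintype.sum_option, Fintype.sum_bool] at h2
  have h3 := congrArg ENNReal.toReal h2
  rw [ENNReal.toReal_add (PMF.apply_ne_top _ _) (by simp [PMF.apply_ne_top]),
    ENNReal.toReal_add (PMF.apply_ne_top _ _) (PMF.apply_ne_top _ _)] at h3
  simp at h1 h3
  linarith

/-! ### Decoding from a partial sample bounds the message length -/

theorem sum_pow_hammingDist {k : ℕ} (l : ℝ) (z : Word k) :
    ∑ x : Word k, l ^ hammingDist x z = (1 + l) ^ k := by
  have h : ∀ x : Word k, l ^ hammingDist x z = ∏ i, if x i ≠ z i then l else 1 := by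
    intro x
    rw [Finset.prod_ite, Finset.prod_const_one, mul_one, Finset.prod_const]
    rfl
  have h2 : ∀ i : Fin k, ∑ b : Bool, (if b ≠ z i then l else 1) = 1 + l := by
    intro i
    cases z i <;> simp [add_comm]
  simp only [h]
  rw [← Fintype.prod_sum (fun i (b : Bool) => if b ≠ z i then l else 1)]
  simp only [h2]
  simp

/-- The decoder has at most `2 ^ S.card` outputs, and each contributes at most a full Hamming
generating function. -/
theorem sum_pow_hammingDist_decoder_le {k n : ℕ} (C : Word k → Word n) (S : Finset (Fin n))
    (g : Word n → Word k) (hg : ∀ w w', (∀ v ∈ S, w v = w' v) → g w = g w') {l : ℝ} (hl : 0 ≤ l) :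
    ∑ x : Word k, l ^ hammingDist x (g (C x)) ≤ 2 ^ S.card * (1 + l) ^ k := by
  set e : (S → Bool) → Word n := fun u v => if h : v ∈ S then u ⟨v, h⟩ else false with he
  have h1 : ∀ x : Word k, l ^ hammingDist x (g (C x)) ≤
      ∑ u : S → Bool, l ^ hammingDist x (g (e u)) := by
    intro x
    have h2 : g (C x) = g (e fun v => C x v) := hg _ _ fun v hv => by simp [he, hv]
    rw [h2]
    exact Finset.single_le_sum (f := fun u => l ^ hammingDist x (g (e u)))
      (fun u _ => by positivity) (Finset.mem_univ fun v : S => C x v)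
  refine (Finset.sum_le_sum fun x _ => h1 x).trans ?_
  rw [Finset.sum_comm]
  simp only [sum_pow_hammingDist]
  simp

/-- At least half of the messages are decoded with at most `k / 8` errors, while few messages lie
that close to one of `2 ^ S.card` outputs; the latter is the generating function at `1 / 4`. -/
theorem le_of_sum_hammingDist_lt {k n : ℕ} (C : Word k → Word n) (S : Finset (Fin n))
    (g : Word n → Word k) (hg : ∀ w w', (∀ v ∈ S, w v = w' v) → g w = g w')
    (h : ∑ x : Word k, (hammingDist x (g (C x)) : ℝ) < 2 ^ k * (k / 16)) :
    k ≤ 3 * (S.card + 1) := by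
  set G := Finset.univ.filter fun x : Word k => hammingDist x (g (C x)) ≤ k / 8 with hG
  have hk : 0 < k := by
    rcases Nat.eq_zero_or_pos k with h0 | h0
    · subst h0
      simp only [CharP.cast_eq_zero, zero_div, mul_zero] at h
      exact absurd h (not_lt.2 (Finset.sum_nonneg fun _ _ => Nat.cast_nonneg _))
    · exact h0
  have hcard : (2 : ℝ) ^ k ≤ 2 * G.card := by
    have h1 : (Gᶜ.card : ℝ) * (k / 8) ≤ ∑ x : Word k, (hammingDist x (g (C x)) : ℝ) := by
      calc (Gᶜ.card : ℝ) * (k / 8) = ∑ x ∈ Gᶜ, (k / 8 : ℝ) := by simp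
        _ ≤ ∑ x ∈ Gᶜ, (hammingDist x (g (C x)) : ℝ) := by
            refine Finset.sum_le_sum fun x hx => ?_
            simp only [hG, Finset.mem_compl, Finset.mem_filter, Finset.mem_univ, true_and,
              not_le] at hx
            have : k ≤ 8 * hammingDist x (g (C x)) := by omega
            rw [div_le_iff₀ (by norm_num)]
            exact_mod_cast (by omega : k ≤ hammingDist x (g (C x)) * 8)
        _ ≤ _ := Finset.sum_le_sum_of_subset_of_nonneg (Finset.subset_univ _)
            fun x _ _ => by positivity
    have h2 : (G.card : ℝ) + Gᶜ.card = 2 ^ k := by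
      have := Finset.card_add_card_compl G
      rw [Fintype.card_fun, Fintype.card_bool, Fintype.card_fin] at this
      exact_mod_cast this
    have hk' : (0 : ℝ) < k := by exact_mod_cast hk
    have h3 : (Gᶜ.card : ℝ) * (k / 8) < (2 ^ k / 2) * (k / 8) := by
      refine (h1.trans_lt h).trans_eq (by ring)
    have h4 := lt_of_mul_lt_mul_right h3 (by positivity)
    linarith
  have hsum : G.card * (1 / 4 : ℝ) ^ (k / 8) ≤ 2 ^ S.card * (5 / 4) ^ k := by
    calc G.card * (1 / 4 : ℝ) ^ (k / 8) = ∑ x ∈ G, (1 / 4 : ℝ) ^ (k / 8) := by simp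
      _ ≤ ∑ x ∈ G, (1 / 4 : ℝ) ^ hammingDist x (g (C x)) := Finset.sum_le_sum fun x hx =>
          pow_le_pow_of_le_one (by norm_num) (by norm_num) (Finset.mem_filter.1 hx).2
      _ ≤ ∑ x, (1 / 4 : ℝ) ^ hammingDist x (g (C x)) :=
          Finset.sum_le_sum_of_subset_of_nonneg (Finset.subset_univ _) fun x _ _ => by positivity
      _ ≤ 2 ^ S.card * (1 + 1 / 4) ^ k :=
          sum_pow_hammingDist_decoder_le C S g hg (by norm_num)
      _ = _ := by norm_num
  have hZ : (1 / 2 : ℝ) ^ k ≤ ((1 / 4 : ℝ) ^ (k / 8)) ^ 4 := by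
    have e : ((1 / 4 : ℝ) ^ (k / 8)) ^ 4 = (1 / 2) ^ (8 * (k / 8)) := by
      rw [← pow_mul, mul_comm (k / 8) 4, pow_mul, pow_mul]
      norm_num
    rw [e]
    exact pow_le_pow_of_le_one (by norm_num) (by norm_num) (by omega)
  set Z := (1 / 4 : ℝ) ^ (k / 8) with hZdef
  have hZ0 : 0 < Z := by positivity
  have h5 : (2 : ℝ) ^ k * Z ≤ 2 ^ (S.card + 1) * (5 / 4) ^ k := by
    calc (2 : ℝ) ^ k * Z ≤ 2 * G.card * Z := by gcongr
      _ = 2 * (G.card * Z) := by ring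
      _ ≤ 2 * (2 ^ S.card * (5 / 4) ^ k) := by gcongr
      _ = _ := by ring
  have h54 : ((5 / 4 : ℝ) ^ k) ^ 3 ≤ 2 ^ k := by
    rw [← pow_mul, mul_comm, pow_mul]
    exact pow_le_pow_left₀ (by norm_num) (by norm_num) k
  -- The bounds `Z ≥ 2 ^ (-k/4)` and `(5/4) ^ k ≤ 2 ^ (k/3)` have fractional exponents; the twelfth
  -- power clears them.
  have h6 : (2 : ℝ) ^ (12 * k) * (1 / 2) ^ (3 * k) ≤ 2 ^ (12 * (S.card + 1)) * 2 ^ (4 * k) := by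
    calc (2 : ℝ) ^ (12 * k) * (1 / 2) ^ (3 * k) = (2 ^ k) ^ 12 * ((1 / 2) ^ k) ^ 3 := by
          rw [← pow_mul, ← pow_mul, mul_comm k 12, mul_comm k 3]
      _ ≤ (2 ^ k) ^ 12 * (Z ^ 4) ^ 3 := by gcongr
      _ = (2 ^ k * Z) ^ 12 := by ring
      _ ≤ (2 ^ (S.card + 1) * (5 / 4) ^ k) ^ 12 := by gcongr
      _ = (2 ^ (S.card + 1)) ^ 12 * (((5 / 4) ^ k) ^ 3) ^ 4 := by ring
      _ ≤ (2 ^ (S.card + 1)) ^ 12 * (2 ^ k) ^ 4 := by gcongr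
      _ = _ := by rw [← pow_mul, ← pow_mul, mul_comm _ 12, mul_comm k 4]
  have h7 : (2 : ℝ) ^ (12 * k) ≤ 2 ^ (12 * (S.card + 1) + 4 * k + 3 * k) := by
    rw [one_div, inv_pow, ← div_eq_mul_inv, div_le_iff₀ (by positivity)] at h6
    rw [pow_add, pow_add]
    exact h6
  have h8 := (pow_le_pow_iff_right₀ (by norm_num : (1 : ℝ) < 2)).1 h7
  omega

theorem le_of_sample_decoder {k n : ℕ} (hk : 1 ≤ k) (C : Word k → Word n)
    (g : Finset (Fin n) → Word n → Word k)
    (hg : ∀ S w w', (∀ v ∈ S, w v = w' v) → g S w = g S w') {p : ℝ} (hp : 0 < p) (hp1 : p ≤ 1)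
    (hn : 0 < n) (h : ∀ x i, bernProb p (fun S => g S (C x) i ≠ x i) ≤ 1 / 64) :
    (k : ℝ) ≤ 3 * (4 * (p * n) + 1) := by
  have hk' : (0 : ℝ) < k := by exact_mod_cast hk
  have hn' : (0 : ℝ) < n := by exact_mod_cast hn
  have hpn : 0 < p * n := by positivity
  have hc : (0 : ℝ) < 2 ^ k * (k / 16) := by positivity
  have hdist : bernExp p (fun S => ∑ x : Word k, (hammingDist x (g S (C x)) : ℝ)) ≤
      2 ^ k * (k / 64) := by
    rw [bernExp_sum]
    calc ∑ x : Word k, bernExp p (fun S => (hammingDist x (g S (C x)) : ℝ))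
        ≤ ∑ _x : Word k, (k / 64 : ℝ) := by
          refine Finset.sum_le_sum fun x _ => ?_
          have e : ∀ S, (hammingDist x (g S (C x)) : ℝ) =
              ∑ i, if g S (C x) i ≠ x i then (1 : ℝ) else 0 := by
            intro S
            rw [Finset.sum_boole, hammingDist_comm]
            rfl
          simp only [e]
          rw [bernExp_sum]
          calc _ ≤ ∑ _i : Fin k, (1 / 64 : ℝ) := by
                refine Finset.sum_le_sum fun i _ => ?_
                refine le_trans (le_of_eq ?_) (h x i)
                unfold bernProb
                congr 1
                funext S
                congr
            _ = k / 64 := by simp; ring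
      _ = 2 ^ k * (k / 64) := by simp
  -- Each normalised term has mean at most `1 / 4`, so one `S` is both small and good for the
  -- average message.
  obtain ⟨S, hS⟩ : ∃ S : Finset (Fin n), (4 * (p * n))⁻¹ * S.card + (2 ^ k * (k / 16) : ℝ)⁻¹ *
      ∑ x : Word k, (hammingDist x (g S (C x)) : ℝ) < 1 := by
    by_contra! hcon
    have h1 := bernExp_mono hp.le hp1 hcon
    rw [bernExp_one, bernExp_add, bernExp_const_mul, bernExp_const_mul, bernExp_card] at h1
    have h2 : (4 * (p * n))⁻¹ * (p * n) = 1 / 4 := by field_simp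
    have h3 : (2 ^ k * (k / 16) : ℝ)⁻¹ * (2 ^ k * (k / 64)) = 1 / 4 := by field_simp; norm_num
    have h4 := mul_le_mul_of_nonneg_left hdist (inv_pos.2 hc).le
    linarith
  have hnn1 : 0 ≤ (4 * (p * n))⁻¹ * S.card := by positivity
  have hnn2 : 0 ≤ (2 ^ k * (k / 16) : ℝ)⁻¹ * ∑ x : Word k, (hammingDist x (g S (C x)) : ℝ) := by
    positivity
  have h1 : (S.card : ℝ) ≤ 4 * (p * n) := by
    have : (4 * (p * n))⁻¹ * S.card ≤ 1 := by linarith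
    rwa [inv_mul_le_iff₀ (by positivity), mul_one] at this
  have h2 : ∑ x : Word k, (hammingDist x (g S (C x)) : ℝ) < 2 ^ k * (k / 16) := by
    have : (2 ^ k * (k / 16) : ℝ)⁻¹ * ∑ x : Word k, (hammingDist x (g S (C x)) : ℝ) < 1 := by
      linarith
    rwa [inv_mul_lt_iff₀ hc, mul_one] at this
  have h3 : (k : ℝ) ≤ 3 * (S.card + 1) := by
    exact_mod_cast le_of_sum_hammingDist_lt C S (g S) (hg S) h2
  linarith

/-! ### The rate of relaxed locally decodable codes -/

/-- Degree thresholds with ratio `n ^ (1 / (Q + 1))`. -/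
def threshold (n Q j : ℕ) : ℝ := if j = 0 then 0 else (n : ℝ) ^ ((j : ℝ) / (Q + 1) - 1)

theorem threshold_mono {n : ℕ} (hn : 1 ≤ n) (Q : ℕ) : Monotone (threshold n Q) := by
  have hn' : (1 : ℝ) ≤ n := by exact_mod_cast hn
  intro i j hij
  rw [threshold, threshold]
  split_ifs with h1 h2
  · rfl
  · positivity
  · omega
  · have : (i : ℝ) ≤ j := by exact_mod_cast hij
    exact Real.rpow_le_rpow_of_exponent_le hn' (by gcongr)

theorem eventually_rpow_ge {a : ℝ} (ha : 0 < a) (B : ℝ) :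
    ∀ᶠ n : ℕ in Filter.atTop, B ≤ (n : ℝ) ^ a :=
  ((tendsto_rpow_atTop ha).comp tendsto_natCast_atTop_atTop).eventually_ge_atTop B

theorem LocalViews.card_heavy_threshold_le {n Q : ℕ} (hn : 1 ≤ n) {Ω : Type*} [Fintype Ω]
    (V : LocalViews n Q Ω) (j : ℕ) :
    ((V.heavy (threshold n Q) (j + 1)).card : ℝ) ≤ Q * (n : ℝ) ^ (1 - ((j : ℝ) + 1) / (Q + 1)) := by
  have hn' : (0 : ℝ) < n := by exact_mod_cast hn
  have h := V.card_heavy_mul_le (threshold n Q) (j + 1)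
  have e : threshold n Q (j + 1) = (n : ℝ) ^ (((j : ℝ) + 1) / (Q + 1) - 1) := by
    simp [threshold]
  rw [e, ← le_div_iff₀ (by positivity)] at h
  refine h.trans_eq ?_
  rw [div_eq_mul_inv, ← Real.rpow_neg hn'.le, neg_sub]

/-- Kernel size times petal degree is of order `n ^ (-1 / (Q + 1))` at every level `j ≥ 1`, while `p
^ j ≥ p ^ Q = n ^ (-1 / (2 * (Q + 1)))`. The remaining power of `n` absorbs the constants. -/
theorem LocalViews.threshold_bound {n Q a : ℕ} (hQ : 1 ≤ Q) (hn : 1 ≤ n) {σ : ℝ} (hσ : 0 < σ)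
    (hB : (Q + a) * Q * 2 ^ Q ≤ σ * (n : ℝ) ^ (1 / (2 * ((Q : ℝ) + 1))))
    {Ω : Type*} [Fintype Ω] (V : LocalViews n Q Ω) {j : ℕ} (hj : j ≤ Q) :
    (((V.heavy (threshold n Q) (j + 1)).card + a : ℕ) : ℝ) * j * (2 ^ Q * threshold n Q j) ≤
      σ * ((n : ℝ) ^ (-(1 / (2 * (Q : ℝ) * (Q + 1))))) ^ j := by
  have hn0 : (0 : ℝ) < n := by exact_mod_cast hn
  have hn1 : (1 : ℝ) ≤ n := by exact_mod_cast hn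
  have hQ0 : (0 : ℝ) < Q := by exact_mod_cast hQ
  rcases Nat.eq_zero_or_pos j with h0 | h0
  · subst h0
    simpa using hσ.le
  have hjQ : (j : ℝ) ≤ Q := by exact_mod_cast hj
  set X := (n : ℝ) ^ (1 - ((j : ℝ) + 1) / (Q + 1)) with hX
  have hX1 : 1 ≤ X := by
    refine Real.one_le_rpow hn1 ?_
    rw [sub_nonneg, div_le_one (by positivity)]
    linarith
  have h1 : (((V.heavy (threshold n Q) (j + 1)).card + a : ℕ) : ℝ) ≤ (Q + a) * X := by
    push_cast
    have := V.card_heavy_threshold_le hn j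
    have h2 : (a : ℝ) ≤ a * X := le_mul_of_one_le_right (by positivity) hX1
    rw [add_mul]
    linarith
  have h2 : threshold n Q j = (n : ℝ) ^ ((j : ℝ) / (Q + 1) - 1) := by
    rw [threshold, if_neg (by omega)]
  have h3 : X * (n : ℝ) ^ ((j : ℝ) / (Q + 1) - 1) = (n : ℝ) ^ (-(1 / ((Q : ℝ) + 1))) := by
    rw [hX, ← Real.rpow_add hn0]
    congr 1
    field_simp
    ring
  have h4 : (n : ℝ) ^ (-(1 / (2 * ((Q : ℝ) + 1)))) ≤
      ((n : ℝ) ^ (-(1 / (2 * (Q : ℝ) * (Q + 1))))) ^ j := by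
    rw [← Real.rpow_mul_natCast hn0.le]
    refine Real.rpow_le_rpow_of_exponent_le hn1 ?_
    rw [neg_mul, neg_le_neg_iff, div_mul_eq_mul_div, one_mul,
      div_le_div_iff₀ (by positivity) (by positivity)]
    have := mul_le_mul_of_nonneg_right hjQ (by positivity : 0 ≤ 2 * ((Q : ℝ) + 1))
    linarith
  have hthr : 0 ≤ threshold n Q j := by rw [h2]; positivity
  calc (((V.heavy (threshold n Q) (j + 1)).card + a : ℕ) : ℝ) * j * (2 ^ Q * threshold n Q j)
      ≤ ((Q + a) * X) * Q * (2 ^ Q * threshold n Q j) := by gcongr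
    _ = ((Q + a) * Q * 2 ^ Q) * (X * (n : ℝ) ^ ((j : ℝ) / (Q + 1) - 1)) := by rw [h2]; ring
    _ ≤ (σ * (n : ℝ) ^ (1 / (2 * ((Q : ℝ) + 1)))) * (n : ℝ) ^ (-(1 / ((Q : ℝ) + 1))) := by
        rw [h3]; gcongr
    _ = σ * (n : ℝ) ^ (-(1 / (2 * ((Q : ℝ) + 1)))) := by
        rw [mul_assoc, ← Real.rpow_add hn0]
        congr 2
        field_simp
        ring
    _ ≤ _ := by gcongr

/-- A code with a `q`-query relaxed decoder has message length at most `15 n ^ (1 - β)` with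
`β = 1 / (2 Q (Q + 1))` and `Q = t q`, provided that `t` repetitions suffice to make the
conjunction of the verdicts `8 (Q + 1)` times more likely on `1` than on `0`. -/
theorem messageLength_le {q t Q : ℕ} (hQt : Q = t * q) (hQ : 1 ≤ Q) (ht : 8 * (Q + 1) ≤ 2 ^ t)
    {δ : ℝ} (hδ : 0 < δ) :
    ∀ᶠ n : ℕ in Filter.atTop, ∀ k : ℕ, 1 ≤ k → ∀ C : Word k → Word n, ∀ D : QueryAlgorithm k n,
      D.QueryComplexityLE q → IsRelaxedDecoder C δ D.run →
        (k : ℝ) ≤ 15 * (n : ℝ) ^ (1 - 1 / (2 * (Q : ℝ) * (Q + 1))) := by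
  have hQ0 : (0 : ℝ) < Q := by exact_mod_cast hQ
  set σ : ℝ := (1 / 3) ^ t with hσdef
  have hσ : 0 < σ := by positivity
  filter_upwards [Filter.eventually_ge_atTop 1,
    eventually_rpow_ge (a := 1 / (2 * ((Q : ℝ) + 1))) (by positivity)
      ((Q + (Q + 32 : ℕ)) * Q * 2 ^ Q / σ),
    eventually_rpow_ge (a := 1 / ((Q : ℝ) + 1)) (by positivity) (Q / δ)]
    with n hn hB hδn k hk C D hDq hD
  have hn0 : (0 : ℝ) < n := by exact_mod_cast hn
  have hn1 : (1 : ℝ) ≤ n := by exact_mod_cast hn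
  rw [div_le_iff₀' hσ] at hB
  set p : ℝ := (n : ℝ) ^ (-(1 / (2 * (Q : ℝ) * (Q + 1)))) with hp
  have hp0 : 0 < p := by positivity
  have hp1 : p ≤ 1 := Real.rpow_le_one_of_one_le_of_nonpos hn1
    (neg_nonpos.2 (by positivity))
  have hpn : p * n = (n : ℝ) ^ (1 - 1 / (2 * (Q : ℝ) * (Q + 1))) := by
    rw [hp, sub_eq_neg_add, Real.rpow_add hn0, Real.rpow_one]
  subst hQt
  set T := threshold n (t * q)
  have hT : Monotone T := threshold_mono hn _
  have hT0 : T 0 = 0 := if_pos rfl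
  classical
  have main := le_of_sample_decoder hk C
    (fun S w i => decide ((D.views q t i).Flag T p σ S w))
    (fun S w w' h => funext fun i => by
      rw [decide_eq_decide]
      exact ⟨LocalViews.flag_of_agree _ _ h,
        LocalViews.flag_of_agree _ _ fun v hv => (h v hv).symm⟩) hp0 hp1 hn ?_
  · rw [← hpn]
    have : 1 ≤ p * n := by
      rw [hpn]
      refine Real.one_le_rpow hn1 ?_
      rw [sub_nonneg, div_le_one (by positivity)]
      have : (1 : ℝ) ≤ (t * q : ℕ) := by exact_mod_cast hQ
      nlinarith
    linarith
  · intro x i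
    set V := D.views q t i
    -- With `a = Q + 32` both errors, `1 / (2 * a)` and `(Q + 1) * (1 / 2) ^ a`, are at most `1 /
    -- 64`.
    have hthr : ∀ j ≤ t * q, (((V.heavy T (j + 1)).card + (t * q + 32) : ℕ) : ℝ) * j *
        (2 ^ (t * q) * T j) ≤ σ * p ^ j := fun j hj => V.threshold_bound hQ hn hσ hB hj
    cases hx : x i with
    | true =>
      have h1 : ((t * q : ℕ) + 1 : ℝ) * (8 * σ) ≤ V.accWeight (C x) := by
        rw [QueryAlgorithm.accWeight_views hDq]
        have h2 := hD.two_thirds_le i x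
        rw [hx] at h2
        have h3 : (8 * ((t * q : ℕ) + 1) : ℝ) ≤ 2 ^ t := by exact_mod_cast ht
        calc ((t * q : ℕ) + 1 : ℝ) * (8 * σ) = (8 * ((t * q : ℕ) + 1)) * σ := by ring
          _ ≤ 2 ^ t * σ := by gcongr
          _ = (2 / 3) ^ t := by rw [hσdef, ← mul_pow]; norm_num
          _ ≤ _ := by gcongr
      refine le_trans ?_ ((V.bernProb_not_flag_le T hT hT0 hp0 hp1 hσ
        (Nat.succ_pos _ : 0 < t * q + 32) hthr h1).trans ?_)
      · exact bernProb_mono hp0.le hp1 fun S hS => by simpa using hS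
      · rw [div_le_div_iff₀ (by positivity) (by positivity)]
        push_cast
        nlinarith
    | false =>
      refine le_trans ?_ ((V.bernProb_flag_le T hT hT0 hp0 hp1 hσ hthr (w := C x) ?_).trans ?_)
      · exact bernProb_mono hp0.le hp1 fun S hS => by simpa using hS
      -- A variant differs from `C x` only on the kernel, which has at most `Q * n ^ (1 - 1 / (Q +
      -- 1)) ≤ δ * n` elements, so relaxed decoding applies to it.
      · intro j hj w' hw'
        rw [QueryAlgorithm.accWeight_views hDq]
        refine pow_le_pow_left₀ ENNReal.toReal_nonneg (hD.le_one_third ?_ hx) t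
        rw [relDist, div_le_iff₀ hn0]
        have h1 : hammingDist w' (C x) ≤ (V.heavy T (j + 1)).card := by
          refine Finset.card_le_card fun v hv => ?_
          by_contra hcon
          exact (Finset.mem_filter.1 hv).2 ((Finset.mem_filter.1 hw').2 v
            (Finset.mem_compl.2 hcon))
        calc (hammingDist w' (C x) : ℝ) ≤ (V.heavy T (j + 1)).card := by exact_mod_cast h1
          _ ≤ (t * q : ℕ) * (n : ℝ) ^ (1 - ((j : ℝ) + 1) / ((t * q : ℕ) + 1)) :=
              V.card_heavy_threshold_le hn j
          _ ≤ (t * q : ℕ) * (n : ℝ) ^ (1 - 1 / (((t * q : ℕ) : ℝ) + 1)) := by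
              have hj0 : (1 : ℝ) ≤ j + 1 := by simp
              have := Real.rpow_le_rpow_of_exponent_le hn1 (sub_le_sub_left
                (div_le_div_of_nonneg_right hj0
                  (by positivity : (0 : ℝ) ≤ ((t * q : ℕ) : ℝ) + 1)) 1)
              gcongr
          _ = (t * q : ℕ) * n / (n : ℝ) ^ (1 / (((t * q : ℕ) : ℝ) + 1)) := by
              rw [Real.rpow_sub hn0, Real.rpow_one, mul_div_assoc]
          _ ≤ δ * n := by
              rw [div_le_iff₀ (by positivity)]
              rw [div_le_iff₀ hδ] at hδn
              nlinarith
      · have h1 : ((t * q : ℕ) + 1 : ℝ) ≤ 2 ^ (t * q) := by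
          exact_mod_cast Nat.lt_two_pow_self
        rw [pow_add, ← mul_assoc]
        calc ((t * q : ℕ) + 1 : ℝ) * (1 / 2) ^ (t * q) * (1 / 2) ^ 32
            ≤ 2 ^ (t * q) * (1 / 2) ^ (t * q) * (1 / 2) ^ 32 := by gcongr
          _ = (1 / 2) ^ 32 := by rw [← mul_pow]; norm_num
          _ ≤ 1 / 64 := by norm_num

/-! ### Decoding globally from a sample -/

/-- Rests on `exp u ≤ 1 + u + u ^ 2` for `|u| ≤ 1`; allowing both signs of `u` covers both tails. -/
theorem bernExp_exp_inter_le {n : ℕ} {p : ℝ} (hp : 0 ≤ p) (hp1 : p ≤ 1) {u : ℝ} (hu : |u| ≤ 1)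
    (A : Finset (Fin n)) :
    bernExp p (fun S => Real.exp (u * (S ∩ A).card)) ≤ Real.exp (p * A.card * (u + u ^ 2)) := by
  have e : ∀ S : Finset (Fin n), Real.exp (u * (S ∩ A).card) = Real.exp u ^ (S ∩ A).card := by
    intro S
    rw [mul_comm, Real.exp_nat_mul]
  simp only [e]
  rw [bernExp_pow_inter]
  have h1 : Real.exp u ≤ 1 + u + u ^ 2 := by
    have := (abs_le.1 (Real.abs_exp_sub_one_sub_id_le hu)).2
    linarith
  have h2 : 1 - p + p * Real.exp u ≤ Real.exp (p * (u + u ^ 2)) := by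
    have h3 := Real.add_one_le_exp (p * (u + u ^ 2))
    have h4 := mul_le_mul_of_nonneg_left h1 hp
    linarith
  have h0 : 0 ≤ 1 - p + p * Real.exp u := by
    have := mul_nonneg hp (Real.exp_pos u).le
    linarith
  calc (1 - p + p * Real.exp u) ^ A.card ≤ Real.exp (p * (u + u ^ 2)) ^ A.card := by gcongr
    _ = Real.exp (p * A.card * (u + u ^ 2)) := by
        rw [← Real.exp_nat_mul]
        congr 1
        ring

/-- Exponential Markov inequality for the size of `S ∩ A`. -/
theorem bernProb_le_mul_card_inter_le {n : ℕ} {p : ℝ} (hp : 0 ≤ p) (hp1 : p ≤ 1) {u : ℝ}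
    (hu : |u| ≤ 1) (A : Finset (Fin n)) (θ : ℝ) :
    bernProb p (fun S => u * θ ≤ u * (S ∩ A).card) ≤
      Real.exp (p * A.card * (u + u ^ 2) - u * θ) := by
  refine (bernProb_le_bernExp hp hp1
    (h := fun S => Real.exp (-(u * θ)) * Real.exp (u * (S ∩ A).card))
    (fun S => by positivity) fun S hS => ?_).trans ?_
  · rw [← Real.exp_add]
    exact Real.one_le_exp (by linarith)
  · rw [bernExp_const_mul, sub_eq_neg_add, Real.exp_add]
    exact mul_le_mul_of_nonneg_left (bernExp_exp_inter_le hp hp1 hu A) (Real.exp_pos _).le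

/-- With `u = -ε / 2` the linear gain `p * n * ε ^ 2 / 2` loses at most half of itself to the
quadratic term. -/
theorem bernProb_card_inter_le {n : ℕ} {p : ℝ} (hp : 0 ≤ p) (hp1 : p ≤ 1) {τ ε : ℝ}
    (hε : 0 < ε) (hε1 : ε ≤ 1) {A : Finset (Fin n)} (hA : (τ + ε) * n ≤ A.card) :
    bernProb p (fun S => ((S ∩ A).card : ℝ) ≤ τ * (p * n)) ≤ Real.exp (-(p * n * ε ^ 2 / 4)) := by
  have hAn : (A.card : ℝ) ≤ n := by
    have := Finset.card_le_univ A
    rw [Fintype.card_fin] at this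
    exact_mod_cast this
  refine (bernProb_mono hp hp1 fun S hS => ?_).trans
    ((bernProb_le_mul_card_inter_le hp hp1 (u := -(ε / 2)) ?_ A (τ * (p * n))).trans
      (Real.exp_le_exp.2 ?_))
  · exact mul_le_mul_of_nonpos_left hS (by linarith)
  · rw [abs_neg, abs_of_pos (by linarith)]; linarith
  · have h1 := mul_le_mul_of_nonneg_left hA (by positivity : 0 ≤ p * (ε / 2))
    have h2 := mul_le_mul_of_nonneg_left hAn (by positivity : 0 ≤ p * (ε / 2) ^ 2)
    nlinarith

theorem bernProb_lt_card_inter {n : ℕ} {p : ℝ} (hp : 0 ≤ p) (hp1 : p ≤ 1) {τ ε : ℝ}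
    (hε : 0 < ε) (hε1 : ε ≤ 1) {A : Finset (Fin n)} (hA : A.card ≤ (τ - ε) * n) :
    bernProb p (fun S => τ * (p * n) < ((S ∩ A).card : ℝ)) ≤ Real.exp (-(p * n * ε ^ 2 / 4)) := by
  have hAn : (A.card : ℝ) ≤ n := by
    have := Finset.card_le_univ A
    rw [Fintype.card_fin] at this
    exact_mod_cast this
  refine (bernProb_mono hp hp1 fun S hS => ?_).trans
    ((bernProb_le_mul_card_inter_le hp hp1 (u := ε / 2) ?_ A (τ * (p * n))).trans
      (Real.exp_le_exp.2 ?_))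
  · exact mul_le_mul_of_nonneg_left hS.le (by linarith)
  · rw [abs_of_pos (by linarith)]; linarith
  · have h1 := mul_le_mul_of_nonneg_left hA (by positivity : 0 ≤ p * (ε / 2))
    have h2 := mul_le_mul_of_nonneg_left hAn (by positivity : 0 ≤ p * (ε / 2) ^ 2)
    nlinarith

theorem bernProb_card_gt {n : ℕ} {p : ℝ} (hp : 0 ≤ p) (hp1 : p ≤ 1) :
    bernProb p (fun S : Finset (Fin n) => 4 * (p * n) < S.card) ≤ Real.exp (-(2 * (p * n))) := by
  refine (bernProb_mono hp hp1 fun S hS => ?_).trans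
    ((bernProb_le_mul_card_inter_le hp hp1 (u := 1) (by simp) Finset.univ (4 * (p * n))).trans
      (Real.exp_le_exp.2 ?_))
  · rw [Finset.inter_univ]
    linarith
  · simp only [Finset.card_univ, Fintype.card_fin]
    linarith

theorem le_sum_bernoulliSubset {n : ℕ} (p : ℝ≥0) (hp : p ≤ 1) {E : Finset (Fin n) → Prop}
    {f : Finset (Fin n) → ℝ≥0∞} (h : ∀ S, E S → 1 ≤ f S) :
    ENNReal.ofReal (bernProb (p : ℝ) E) ≤ ∑ S, bernoulliSubset n p hp S * f S := by
  classical
  have hp' : (0 : ℝ) ≤ 1 - p := sub_nonneg.2 (by exact_mod_cast hp)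
  rw [bernProb, bernExp, ENNReal.ofReal_sum_of_nonneg fun S _ => by
    have : (0 : ℝ) ≤ p := p.coe_nonneg
    split_ifs <;> positivity]
  refine Finset.sum_le_sum fun S _ => ?_
  by_cases hE : E S
  · have e : ENNReal.ofReal ((p : ℝ) ^ S.card * (1 - p) ^ (n - S.card)) = bernoulliSubset n p hp S := by
      rw [bernoulliSubset, PMF.ofFintype_apply, ← ENNReal.ofReal_coe_nnreal]
      congr 1
      push_cast
      rw [NNReal.coe_sub hp]
      rfl
    rw [if_pos hE, mul_one, e]
    exact le_mul_of_one_le_right' (h S hE)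
  · simp [hE]

/-- The coordinates on which two words differ. -/
def diffSet {n : ℕ} (w w' : Word n) : Finset (Fin n) := Finset.univ.filter fun v => w v ≠ w' v

open Classical in
/-- Search for a message whose encoding differs from the sampled string in at most `θ` sampled
coordinates, and answer according to this message. -/
def sampleDecoder {k n : ℕ} (C : Word k → Word n) (p : ℝ≥0) (hp : p ≤ 1) (cap : ℕ) (θ : ℝ) :
    SampleAlgorithm k n where
  prob := p
  prob_le_one := hp
  cap := cap
  out i Q v :=
    if h : ∃ y : Word k, ((Finset.univ.filter fun j : Q => v j ≠ C y j).card : ℝ) ≤ θ then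
      PMF.pure (some (h.choose i)) else PMF.pure none
  overflow _ _ := PMF.pure none

theorem card_filter_ne_restrict {n : ℕ} (Q : Finset (Fin n)) (w w' : Word n) :
    (Finset.univ.filter fun j : Q => w j ≠ w' j).card = (Q ∩ diffSet w w').card := by
  rw [← Finset.card_map (Function.Embedding.subtype _)]
  congr 1
  ext v
  simp [diffSet, and_comm]

section SampleDecoder

variable {k n : ℕ} {C : Word k → Word n} {p : ℝ≥0} {hp : p ≤ 1} {cap : ℕ} {θ : ℝ}

/-- All other messages exceed the threshold, so the arbitrary choice is forced to be `x`. -/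
theorem sampleDecoder_out_of_exists {w : Word n} {x : Word k} {Q : Finset (Fin n)}
    (hQ : ∀ y ≠ x, θ < ((Q ∩ diffSet w (C y)).card : ℝ))
    (hx : ((Q ∩ diffSet w (C x)).card : ℝ) ≤ θ) (i : Fin k) :
    (sampleDecoder C p hp cap θ).out i Q (fun j => w j) = PMF.pure (some (x i)) := by
  have h : ∃ y : Word k, ((Finset.univ.filter fun j : Q => w j ≠ C y j).card : ℝ) ≤ θ :=
    ⟨x, by rwa [card_filter_ne_restrict]⟩
  have hx : h.choose = x := by
    by_contra hne
    have := h.choose_spec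
    rw [card_filter_ne_restrict] at this
    exact absurd this (not_le.2 (hQ _ hne))
  simp only [sampleDecoder]
  rw [dif_pos h, hx]

theorem sampleDecoder_out_of_not_exists {w : Word n} {Q : Finset (Fin n)}
    (hQ : ∀ y, θ < ((Q ∩ diffSet w (C y)).card : ℝ)) (i : Fin k) :
    (sampleDecoder C p hp cap θ).out i Q (fun j => w j) = PMF.pure none := by
  simp only [sampleDecoder, card_filter_ne_restrict]
  exact dif_neg fun ⟨y, hy⟩ => absurd hy (not_le.2 (hQ y))

theorem sampleDecoder_run_apply (i : Fin k) (w : Word n) (o : Option Bool) :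
    (sampleDecoder C p hp cap θ).run i w o = ∑ Q, bernoulliSubset n p hp Q *
      (if Q.card ≤ cap then (sampleDecoder C p hp cap θ).out i Q (fun j => w j)
        else PMF.pure none) o := by
  rw [SampleAlgorithm.run, PMF.bind_apply, tsum_fintype]
  rfl

theorem two_thirds_le_of_bernProb_not_le {E : Finset (Fin n) → Prop}
    {f : Finset (Fin n) → ℝ≥0∞} (hE : bernProb (p : ℝ) (fun S => ¬ E S) ≤ 1 / 3)
    (h : ∀ S, E S → 1 ≤ f S) : 2 / 3 ≤ ∑ S, bernoulliSubset n p hp S * f S := by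
  refine le_trans ?_ (le_sum_bernoulliSubset p hp h)
  have h1 := bernProb_compl (p : ℝ) E
  have h2 : (2 / 3 : ℝ) ≤ bernProb (p : ℝ) E := by linarith
  refine le_trans (le_of_eq ?_) (ENNReal.ofReal_le_ofReal h2)
  rw [ENNReal.ofReal_div_of_pos (by norm_num)]
  norm_num

/-- Union bound over at most `2 ^ k` far codewords, each failing with probability at most `2 ^ (-(k
+ 4))`, plus overflow. This is where the sample must outgrow `k`. The bound `2/9` leaves `1/9` for
the near codeword. -/
theorem bernProb_not_good_le {τ ε : ℝ} (hε : 0 < ε) (hε1 : ε ≤ 1) (hp : p ≤ 1)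
    (hpn : (k : ℝ) + 4 ≤ p * n * ε ^ 2 / 4) (hcap : 4 * (p * n : ℝ) < cap + 1)
    {w : Word n} {x : Word k} (hfar : ∀ y ≠ x, (τ + ε) * n ≤ hammingDist w (C y)) :
    bernProb (p : ℝ) (fun S => ¬ (S.card ≤ cap ∧
      ∀ y ≠ x, τ * (p * n) < ((S ∩ diffSet w (C y)).card : ℝ))) ≤ 2 / 9 := by
  have hp' : (p : ℝ) ≤ 1 := by exact_mod_cast hp
  have hexp : ∀ m : ℕ, Real.exp (-(m : ℝ)) ≤ (1 / 2) ^ m := by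
    intro m
    have h1 : Real.exp (-1) ≤ 1 / 2 := by
      rw [Real.exp_neg, inv_le_comm₀ (Real.exp_pos _) (by norm_num)]
      have := Real.add_one_le_exp (1 : ℝ)
      norm_num at this ⊢
      linarith
    have e : Real.exp (-(m : ℝ)) = Real.exp (-1) ^ m := by
      rw [← Real.exp_nat_mul]; congr 1; ring
    rw [e]
    exact pow_le_pow_left₀ (Real.exp_pos _).le h1 m
  have hbig : 4 ≤ 2 * (p * n : ℝ) := by
    have h1 : ε ^ 2 ≤ 1 := pow_le_one₀ hε.le hε1
    have h2 : (p * n : ℝ) * ε ^ 2 ≤ p * n * 1 := by gcongr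
    have h3 : (0 : ℝ) ≤ k := by positivity
    linarith
  have hfew : ∀ y ∈ Finset.univ.erase x, bernProb (p : ℝ)
      (fun S => ((S ∩ diffSet w (C y)).card : ℝ) ≤ τ * (p * n)) ≤ (1 / 2) ^ (k + 4) := by
    intro y hy
    refine (bernProb_card_inter_le p.coe_nonneg hp' hε hε1 (hfar y (Finset.ne_of_mem_erase hy))).trans
      (le_trans (Real.exp_le_exp.2 ?_) (hexp (k + 4)))
    push_cast
    linarith
  calc _ ≤ bernProb (p : ℝ) (fun S => 4 * (p * n : ℝ) < S.card ∨
        ∃ y ∈ Finset.univ.erase x, ((S ∩ diffSet w (C y)).card : ℝ) ≤ τ * (p * n)) := by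
        refine bernProb_mono p.coe_nonneg hp' fun S hS => ?_
        by_contra! hcon
        refine hS ⟨?_, fun y hy => hcon.2 y (Finset.mem_erase.2 ⟨hy, Finset.mem_univ y⟩)⟩
        have h1 : (S.card : ℝ) < cap + 1 := hcon.1.trans_lt hcap
        have h2 : S.card < cap + 1 := by exact_mod_cast h1
        omega
    _ ≤ Real.exp (-(2 * (p * n))) + ∑ y ∈ Finset.univ.erase x, (1 / 2 : ℝ) ^ (k + 4) :=
        (bernProb_or_le p.coe_nonneg hp' _ _).trans (add_le_add (bernProb_card_gt p.coe_nonneg hp')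
          ((bernProb_exists_le p.coe_nonneg hp' _ _).trans (Finset.sum_le_sum hfew)))
    _ ≤ (1 / 2) ^ 4 + 2 ^ k * (1 / 2) ^ (k + 4) := by
        gcongr
        · refine le_trans (Real.exp_le_exp.2 ?_) (hexp 4)
          push_cast
          linarith
        · rw [Finset.sum_const, nsmul_eq_mul]
          gcongr
          have : (Finset.univ.erase x).card ≤ 2 ^ k := by
            refine (Finset.card_erase_le).trans ?_
            simp
          exact_mod_cast this
    _ ≤ 2 / 9 := by
        rw [pow_add, ← mul_assoc, ← mul_pow]
        norm_num

/-- On the good event only `x` can pass the threshold: the answer is `x i` if it does and `⊥`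
otherwise, so no nearness is needed. -/
theorem sampleDecoder_relaxed {τ ε : ℝ} (hε : 0 < ε) (hε1 : ε ≤ 1)
    (hpn : (k : ℝ) + 4 ≤ p * n * ε ^ 2 / 4) (hcap : 4 * (p * n : ℝ) < cap + 1)
    {w : Word n} {x : Word k} (hfar : ∀ y ≠ x, (τ + ε) * n ≤ hammingDist w (C y)) (i : Fin k) :
    2 / 3 ≤ (sampleDecoder C p hp cap (τ * (p * n))).run i w (some (x i)) +
      (sampleDecoder C p hp cap (τ * (p * n))).run i w none := by
  rw [sampleDecoder_run_apply, sampleDecoder_run_apply, ← Finset.sum_add_distrib]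
  simp only [← mul_add]
  refine two_thirds_le_of_bernProb_not_le
    ((bernProb_not_good_le hε hε1 hp hpn hcap hfar).trans (by norm_num)) fun S hS => ?_
  rw [if_pos hS.1]
  by_cases hx : ((S ∩ diffSet w (C x)).card : ℝ) ≤ τ * (p * n)
  · rw [sampleDecoder_out_of_exists hS.2 hx]
    simp
  · rw [sampleDecoder_out_of_not_exists fun y => ?_]
    · simp
    · by_cases hy : y = x
      · rw [hy]; exact not_le.1 hx
      · exact hS.2 y hy

theorem sampleDecoder_correct {τ ε : ℝ} (hε : 0 < ε) (hε1 : ε ≤ 1)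
    (hpn : (k : ℝ) + 4 ≤ p * n * ε ^ 2 / 4) (hcap : 4 * (p * n : ℝ) < cap + 1)
    {w : Word n} {x : Word k} (hfar : ∀ y ≠ x, (τ + ε) * n ≤ hammingDist w (C y))
    (hnear : (hammingDist w (C x) : ℝ) ≤ (τ - ε) * n) (i : Fin k) :
    2 / 3 ≤ (sampleDecoder C p hp cap (τ * (p * n))).run i w (some (x i)) := by
  have hp' : (p : ℝ) ≤ 1 := by exact_mod_cast hp
  rw [sampleDecoder_run_apply]
  refine two_thirds_le_of_bernProb_not_le (E := fun S => (S.card ≤ cap ∧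
      ∀ y ≠ x, τ * (p * n) < ((S ∩ diffSet w (C y)).card : ℝ)) ∧
      ((S ∩ diffSet w (C x)).card : ℝ) ≤ τ * (p * n)) ?_ fun S hS => ?_
  · have h1 := bernProb_not_good_le hε hε1 hp hpn hcap hfar
    have h2 : bernProb (p : ℝ) (fun S => τ * (p * n) < ((S ∩ diffSet w (C x)).card : ℝ)) ≤
        1 / 9 := by
      refine (bernProb_lt_card_inter p.coe_nonneg hp' hε hε1 hnear).trans ?_
      have h3 : Real.exp (-(p * n * ε ^ 2 / 4)) ≤ Real.exp (-4) := by
        refine Real.exp_le_exp.2 ?_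
        have : (0 : ℝ) ≤ k := by positivity
        linarith
      refine h3.trans ?_
      rw [Real.exp_neg, inv_le_comm₀ (Real.exp_pos _) (by norm_num)]
      have h4 := Real.add_one_le_exp (2 : ℝ)
      have h5 : Real.exp 4 = Real.exp 2 * Real.exp 2 := by rw [← Real.exp_add]; norm_num
      rw [h5]
      nlinarith
    refine (bernProb_mono p.coe_nonneg hp' fun S hS => ?_).trans
      ((bernProb_or_le p.coe_nonneg hp' _ _).trans ((add_le_add h1 h2).trans (by norm_num)))
    by_contra! hcon
    exact hS hcon
  · rw [if_pos hS.1.1, sampleDecoder_out_of_exists hS.1.2 hS.2]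
    simp

/-- If words in the balls of radius `δ` around codewords are `(τ + ε)`-far from all other codewords,
then the sample decoder with threshold `τ` is a relaxed decoder, and decodes every bit if
`δ ≤ τ - ε`. -/
theorem sampleDecoder_spec {δ τ ε : ℝ} (hn : 1 ≤ n) (hδ : 0 ≤ δ) (hε : 0 < ε) (hε1 : ε ≤ 1)
    (hετ : ε ≤ τ) (hpn : (k : ℝ) + 4 ≤ p * n * ε ^ 2 / 4) (hcap : 4 * (p * n : ℝ) < cap + 1)
    (hfar : ∀ (w : Word n) (x : Word k), relDist w (C x) ≤ δ → ∀ y ≠ x,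
      τ + ε ≤ relDist w (C y)) :
    IsRelaxedDecoder C δ (sampleDecoder C p hp cap (τ * (p * n))).run ∧
      (δ ≤ τ - ε → HasSuccessRate C δ 1 (sampleDecoder C p hp cap (τ * (p * n))).run) := by
  have hn0 : (0 : ℝ) < n := by exact_mod_cast hn
  have hfar' : ∀ (w : Word n) (x : Word k), relDist w (C x) ≤ δ → ∀ y ≠ x,
      (τ + ε) * n ≤ hammingDist w (C y) := fun w x hw y hy =>
    (le_div_iff₀ hn0).1 (hfar w x hw y hy)
  refine ⟨⟨fun i x => ?_, fun i w x hw => ?_⟩, fun hδτ w x hw => ?_⟩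
  · refine sampleDecoder_correct hε hε1 hpn hcap (hfar' _ x ?_) ?_ i
    · simpa [relDist] using hδ
    · rw [hammingDist_self, Nat.cast_zero]
      exact mul_nonneg (by linarith) hn0.le
  · exact sampleDecoder_relaxed hε hε1 hpn hcap (hfar' _ x hw) i
  · refine ⟨Finset.univ, by simp, fun i _ =>
      sampleDecoder_correct hε hε1 hpn hcap (hfar' _ x hw) ?_ i⟩
    exact (div_le_iff₀ hn0).1 (hw.trans hδτ)

end SampleDecoder

/-! ### Code distance -/

theorem codeDist_le {k n : ℕ} (C : Word k → Word n) {x y : Word k} (h : x ≠ y) :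
    codeDist C ≤ relDist (C x) (C y) := by
  refine csInf_le ⟨0, ?_⟩ ⟨x, y, h, rfl⟩
  rintro d ⟨x, y, -, rfl⟩
  exact div_nonneg (Nat.cast_nonneg _) (Nat.cast_nonneg _)

theorem relDist_triangle {n : ℕ} (x y z : Word n) :
    relDist x z ≤ relDist x y + relDist y z := by
  rw [relDist, relDist, relDist, ← add_div]
  have : (hammingDist x z : ℝ) ≤ hammingDist x y + hammingDist y z := by
    exact_mod_cast hammingDist_triangle x y z
  gcongr

theorem codeDist_le_one {k n : ℕ} (hk : 1 ≤ k) (C : Word k → Word n) : codeDist C ≤ 1 := by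
  have hne : (fun _ => true : Word k) ≠ fun _ => false := fun h => by
    simpa using congrFun h ⟨0, hk⟩
  refine (codeDist_le C hne).trans (div_le_one_of_le₀ ?_ (Nat.cast_nonneg _))
  have := hammingDist_le_card_fintype (x := C fun _ => true) (y := C fun _ => false)
  rw [Fintype.card_fin] at this
  exact_mod_cast this

theorem codeDist_sub_le_relDist {k n : ℕ} (C : Word k → Word n) {δ : ℝ} {w : Word n}
    {x y : Word k} (hw : relDist w (C x) ≤ δ) (hy : y ≠ x) : codeDist C - δ ≤ relDist w (C y) := by
  have h1 := codeDist_le C hy.symm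
  have h2 := relDist_triangle (C x) w (C y)
  have h3 : relDist (C x) w = relDist w (C x) := by rw [relDist, relDist, hammingDist_comm]
  linarith

/-! ### Repetitions -/

/-- The number of repetitions of a `q`-query decoder. -/
def repetitions (q : ℕ) : ℕ := 10 * (Nat.log 2 q + 1)

/-- Logarithmically many repetitions already suffice, which keeps `Q` at `O(q log q)`. -/
theorem le_two_pow_repetitions {q : ℕ} : 8 * (repetitions q * q + 1) ≤ 2 ^ repetitions q := by
  set L := Nat.log 2 q + 1 with hL
  have h1 : q < 2 ^ L := Nat.lt_pow_succ_log_self one_lt_two q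
  have h2 : L < 2 ^ L := Nat.lt_two_pow_self
  have hL1 : 1 ≤ L := Nat.succ_pos _
  have h3 : repetitions q * q + 1 ≤ 10 * (2 ^ L * 2 ^ L) := by
    calc repetitions q * q + 1 ≤ 10 * L * (q + 1) := by
          change 10 * L * q + 1 ≤ _
          nlinarith
      _ ≤ 10 * (2 ^ L) * 2 ^ L := Nat.mul_le_mul (Nat.mul_le_mul_left 10 h2.le) h1
      _ = _ := by ring
  calc 8 * (repetitions q * q + 1) ≤ 8 * (10 * (2 ^ L * 2 ^ L)) := Nat.mul_le_mul_left 8 h3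
    _ ≤ 2 ^ 7 * (2 ^ L * 2 ^ L) := by
        have := Nat.zero_le (2 ^ L * 2 ^ L)
        omega
    _ = 2 ^ (7 + L + L) := by ring
    _ ≤ 2 ^ repetitions q := Nat.pow_le_pow_right two_pos (by change _ ≤ 10 * L; omega)

theorem repetitions_mul_le {q : ℕ} (hq : 2 ≤ q) :
    ((repetitions q * q : ℕ) : ℝ) ≤ 40 * (q * Real.log q) := by
  have hq0 : (0 : ℝ) < q := by positivity
  have hlog2 : (1 : ℝ) / 2 ≤ Real.log 2 := by linarith [Real.log_two_gt_d9]
  have h1 : (Nat.log 2 q : ℝ) * Real.log 2 ≤ Real.log q := by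
    rw [← Real.log_pow]
    refine Real.log_le_log (by positivity) ?_
    exact_mod_cast Nat.pow_log_le_self 2 (by omega)
  have h2 : Real.log 2 ≤ Real.log q := Real.log_le_log (by norm_num) (by exact_mod_cast hq)
  have h3 : (Nat.log 2 q : ℝ) * (1 / 2) ≤ Nat.log 2 q * Real.log 2 := by gcongr
  have h4 : (repetitions q : ℝ) ≤ 40 * Real.log q := by
    rw [repetitions]
    push_cast
    linarith
  push_cast
  calc (repetitions q : ℝ) * q ≤ 40 * Real.log q * q := by gcongr
    _ = _ := by ring

/-- Here `12800 = 8 * 40 ^ 2`, from `4 * Q * (Q + 1) ≤ 8 * Q ^ 2`. The factor `2` leaves a margin `n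
^ γ` between `k` and the sample size. -/
theorem two_mul_exponent_le {q Q : ℕ} (hq : 2 ≤ q) (hQ : Q = repetitions q * q) (hQ1 : 1 ≤ Q) :
    2 * (1 / (12800 * (q : ℝ) ^ 2 * Real.log q ^ 2)) ≤ 1 / (2 * (Q : ℝ) * (Q + 1)) := by
  have h1 : (Q : ℝ) ≤ 40 * (q * Real.log q) := hQ ▸ repetitions_mul_le hq
  have hQ' : (1 : ℝ) ≤ Q := by exact_mod_cast hQ1
  have hlog : 0 < Real.log q := Real.log_pos (by exact_mod_cast hq)
  have hq0 : (0 : ℝ) < q := by positivity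
  rw [mul_one_div, div_le_div_iff₀ (by positivity) (by positivity)]
  have h2 : (Q : ℝ) ^ 2 ≤ (40 * (q * Real.log q)) ^ 2 := by gcongr
  nlinarith

end RelaxedLDC

end

/-! ### Choice of parameters and conclusion -/

theorem corollary7p4 :
    ∃ c : ℝ, 0 < c ∧
      ∀ q : ℕ, 2 ≤ q → ∀ δ : ℝ, 0 < δ →
        ∃ (ρ : ℝ) (n₀ : ℕ) (n₁ : ℝ → ℕ), 0 < ρ ∧
          ∀ n : ℕ, n₀ ≤ n → ∀ k : ℕ, 1 ≤ k →
            ∀ C : RelaxedLDC.Word k → RelaxedLDC.Word n, Function.Injective C →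
              δ < RelaxedLDC.codeDist C / 2 →
              (∃ D : RelaxedLDC.QueryAlgorithm k n,
                D.QueryComplexityLE q ∧ RelaxedLDC.IsRelaxedDecoder C (δ / 2) D.run) →
              ∃ D' : RelaxedLDC.SampleAlgorithm k n,
                (D'.cap : ℝ) ≤ (n : ℝ) ^ (1 - 1 / (c * (q : ℝ) ^ 2 * Real.log q ^ 2)) ∧
                RelaxedLDC.IsRelaxedDecoder C δ D'.run ∧
                ∀ η : ℝ, 0 < η → 2 * δ + η ≤ RelaxedLDC.codeDist C → n₁ η ≤ n →
                  RelaxedLDC.HasSuccessRate C δ ρ D'.run := by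
  refine ⟨12800, by norm_num, fun q hq δ hδ => ?_⟩
  set γ : ℝ := 1 / (12800 * (q : ℝ) ^ 2 * Real.log q ^ 2) with hγdef
  have hlog : 0 < Real.log q := Real.log_pos (by exact_mod_cast hq)
  have hγ : 0 < γ := by positivity
  obtain ⟨Q, hQ⟩ : ∃ Q, Q = RelaxedLDC.repetitions q * q := ⟨_, rfl⟩
  have hQ1 : 1 ≤ Q := by
    rw [hQ]
    exact Nat.mul_pos (Nat.mul_pos (by norm_num) (Nat.succ_pos _)) (by omega)
  have hQ1' : (1 : ℝ) ≤ Q := by exact_mod_cast hQ1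
  have hγβ : 2 * γ ≤ 1 / (2 * (Q : ℝ) * (Q + 1)) := RelaxedLDC.two_mul_exponent_le hq hQ hQ1
  have hβ1 : 1 / (2 * (Q : ℝ) * (Q + 1)) ≤ 1 := by
    rw [div_le_one (by positivity)]
    nlinarith
  obtain ⟨N₀, hN₀⟩ := Filter.eventually_atTop.1 (RelaxedLDC.messageLength_le hQ hQ1
    (by rw [hQ]; exact RelaxedLDC.le_two_pow_repetitions) (half_pos hδ))
  -- `304 = 16 * 19`: `k + 4` is at most `19 * n ^ (1 - 2γ)`, and `p * n * ε ^ 2 / 4` equals `n ^ (1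
  -- - γ) * ε ^ 2 / 16`.
  choose N hN using fun ε : ℝ =>
    Filter.eventually_atTop.1 (RelaxedLDC.eventually_rpow_ge hγ (304 / ε ^ 2))
  refine ⟨1, max 1 (max N₀ (N (δ / 2))), fun η => N (η / 2), one_pos, ?_⟩
  rintro n hn k hk C - hC ⟨D, hDq, hD⟩
  have hn1 : 1 ≤ n := (le_max_left _ _).trans hn
  have hnN₀ : N₀ ≤ n := (le_max_left _ _).trans ((le_max_right _ _).trans hn)
  have hnN : N (δ / 2) ≤ n := (le_max_right _ _).trans ((le_max_right _ _).trans hn)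
  have hn0 : (0 : ℝ) < n := by exact_mod_cast hn1
  have hn1' : (1 : ℝ) ≤ n := by exact_mod_cast hn1
  have hkn := hN₀ n hnN₀ k hk C D hDq hD
  have hC1 := RelaxedLDC.codeDist_le_one hk C
  -- The `1 / 4` lets the cap be four times the mean sample size.
  set p : ℝ≥0 := ⟨(n : ℝ) ^ (-γ) / 4, by positivity⟩ with hpdef
  have hpval : (p : ℝ) = (n : ℝ) ^ (-γ) / 4 := rfl
  have hp : p ≤ 1 := by
    have h1 : (n : ℝ) ^ (-γ) ≤ 1 := Real.rpow_le_one_of_one_le_of_nonpos hn1' (by linarith)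
    have h2 : (p : ℝ) ≤ 1 := by rw [hpval]; linarith
    exact_mod_cast h2
  have hpn : 4 * (p * n : ℝ) = (n : ℝ) ^ (1 - γ) := by
    rw [hpval, sub_eq_neg_add, Real.rpow_add hn0, Real.rpow_one]
    ring
  have hcap : 4 * (p * n : ℝ) < (⌊(n : ℝ) ^ (1 - γ)⌋₊ : ℝ) + 1 := by
    rw [hpn]
    exact Nat.lt_floor_add_one _
  have hsize : ∀ ε : ℝ, 0 < ε → N ε ≤ n → (k : ℝ) + 4 ≤ p * n * ε ^ 2 / 4 := by
    intro ε hε hNε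
    have h1 := hN ε n hNε
    rw [div_le_iff₀ (by positivity)] at h1
    have h2 : (n : ℝ) ^ (1 - 1 / (2 * (Q : ℝ) * (Q + 1))) ≤ (n : ℝ) ^ (1 - γ - γ) :=
      Real.rpow_le_rpow_of_exponent_le hn1' (by linarith)
    have h3 : 1 ≤ (n : ℝ) ^ (1 - γ - γ) := Real.one_le_rpow hn1' (by linarith)
    have h4 : (n : ℝ) ^ (1 - γ) = (n : ℝ) ^ (1 - γ - γ) * (n : ℝ) ^ γ := by
      rw [← Real.rpow_add hn0]
      congr 1
      ring
    have h5 := mul_le_mul_of_nonneg_left h1 (by linarith : 0 ≤ (n : ℝ) ^ (1 - γ - γ))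
    have h6 : (p : ℝ) * n = (n : ℝ) ^ (1 - γ - γ) * (n : ℝ) ^ γ / 4 := by rw [← h4]; linarith
    rw [h6]
    linarith
  -- One decoder must serve all `η`. If some `η` is admissible, the threshold `δ + η / 2` separates
  -- near from far codewords and every bit is decoded. Otherwise the success claim is vacuous, and
  -- the threshold `δ / 2` still accepts exact codewords and rejects wrong ones.
  by_cases hη : ∃ η : ℝ, 0 < η ∧ 2 * δ + η ≤ RelaxedLDC.codeDist C ∧ N (η / 2) ≤ n
  · obtain ⟨η, hη0, hηC, hηN⟩ := hη
    obtain ⟨h1, h2⟩ := RelaxedLDC.sampleDecoder_spec (C := C) (p := p) (hp := hp) (δ := δ)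
      (τ := δ + η / 2) (ε := η / 2) hn1 hδ.le (half_pos hη0) (by linarith) (by linarith)
      (hsize _ (half_pos hη0) hηN) hcap fun w x hw y hy => by
        have := RelaxedLDC.codeDist_sub_le_relDist C hw hy
        linarith
    exact ⟨_, Nat.floor_le (by positivity), h1, fun _ _ _ _ => h2 (by linarith)⟩
  · obtain ⟨h1, -⟩ := RelaxedLDC.sampleDecoder_spec (C := C) (p := p) (hp := hp) (δ := δ)
      (τ := δ / 2) (ε := δ / 2) hn1 hδ.le (half_pos hδ) (by linarith) le_rfl
      (hsize _ (half_pos hδ) hnN) hcap fun w x hw y hy => by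
        have := RelaxedLDC.codeDist_sub_le_relDist C hw hy
        linarith
    exact ⟨_, Nat.floor_le (by positivity), h1, fun η h2 h3 h4 => absurd ⟨η, h2, h3, h4⟩ hη⟩
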